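/- Let $G$ be a strongly regular graph with parameters $(85,14,3,2)$, that is, a 14-regular graph on 85 vertices in which two adjacent vertices have exactly 3 common neighbours and two distinct non-adjacent vertices have exactly 2. For a vertex $x$ of $G$, let $G_1(x)$ be the subgraph of $G$ induced on the neighbours of $x$. Call a (simple) graph a good cubic graph if it has 14 vertices, every vertex has degree 3, and any two distinct non-adjacent vertices have at most one common neighbour. Proposition. Up to isomorphism there are exactly 39 good cubic graphs. Of these, 36 are connected, and the other 3 are disjoint unions of $K_4$ and a connected cubic graph on 10 vertices; one of these 3 is the disjoint union of $K_4$ and the Petersen graph. For every strongly regular graph $G$ with parameters $(85,14,3,2)$ and every vertex $x$ of $G$, the local subgraph $G_1(x)$ is a good cubic graph, and hence is isomorphic to one of these 39 graphs. -/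

import Mathlib

/-- A graph is cubic if every vertex has exactly three neighbours
(`Set.ncard` is `0` on infinite sets, so this also says the neighbourhoods are finite). -/
def SimpleGraph.IsCubic {V : Type*} (H : SimpleGraph V) : Prop :=
  ∀ v, (H.neighborSet v).ncard = 3

/-- A good cubic graph: a cubic graph on `14` vertices in which any two distinct
non-adjacent vertices have at most one common neighbour. -/
structure SimpleGraph.IsGoodCubic {V : Type*} (H : SimpleGraph V) : Prop where
  card : Nat.card V = 14
  cubic : H.IsCubic
  common : ∀ v w, v ≠ w → ¬ H.Adj v w → (H.commonNeighbors v w).ncard ≤ 1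

/-- The Petersen graph: its vertices are the `2`-element subsets of a `5`-element set,
two of them being adjacent when they are disjoint. -/
def petersenGraph : SimpleGraph {s : Finset (Fin 5) // s.card = 2} where
  Adj s t := Disjoint s.1 t.1
  symm := ⟨fun _ _ h => h.symm⟩
  loopless := ⟨fun s h => by
    have h0 : s.1 = ∅ := by simpa using h
    have h2 := s.2
    simp [h0] at h2⟩

/-- The local subgraph `G_1(x)`: the subgraph of `G` induced on the neighbours of `x`. -/
abbrev SimpleGraph.localGraph {V : Type*} (G : SimpleGraph V) (x : V) :
    SimpleGraph (G.neighborSet x) :=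
  G.induce (G.neighborSet x)

/-! The statement about local graphs is immediate from the parameters: k = 14 counts the vertices, λ
= 3 gives the degree, and of the μ = 2 common neighbours of two non-adjacent neighbours of x one is
x itself (`SimpleGraph.IsSRGWith.isGoodCubic_localGraph`). The rest is a computer classification
with a checked certificate.

A pattern stands for a graph known to be a subgraph, not necessarily induced, of a good cubic graph
H. If a vertex has fewer than three known neighbours, a further one exists, and it is either a
vertex already present that still has room or a new vertex (`Pattern.Realizes.exists_extension`).
Branching in this way from a single vertex has two kinds of leaves. One is a 4-cycle with a pendant
edge, which no good cubic graph contains (`Pattern.not_realizes_banner`), so that every 4-cycle lies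
in a K₄. The other is one of the 39 listed graphs: a spanning cubic subgraph of a cubic graph is the
whole graph (`Pattern.CubicTable.nonempty_iso`).

Without isomorph rejection the tree would be far too large. Instead, the search is split into a
sequence of patterns, each settled with the help of the earlier ones: a branch ends as soon as an
earlier pattern embeds into it (`Pattern.Realizes.comp`). The order disposes first of graphs with
two triangles sharing an edge, then of all graphs with a triangle, then of the triangle-free ones.
The branchings and embeddings are supplied as data. The kernel checks them in
`Pattern.settlesAll_searchList`, and `Pattern.forced_of_settlesAll` turns the check into the
theorem.

The 39 graphs are told apart by the sum of the squares of the numbers of closed 7-walks at their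
vertices. A graph is connected if every vertex but the first has a smaller neighbour; the last three
are visibly sums with K₄. -/

/-! ### Patterns and their extensions -/

/-- A pattern on the vertices `0, 1, …`: the list of its neighbour lists. -/
abbrev Pattern := List (List ℕ)

namespace Pattern

/-- The neighbours of `a` in the pattern `P`. Like other definitions below that are meant for
evaluation in the kernel, this one uses a recursor directly. -/
noncomputable def row (P : Pattern) (a : ℕ) : List ℕ :=
  List.rec (fun _ => []) (fun r _ ih a => Nat.rec r (fun a _ => ih a) a) P a

/-- Membership in a list of natural numbers. -/
noncomputable def mem (a : ℕ) (l : List ℕ) : Bool :=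
  List.rec false (fun b _ ih => cond (Nat.beq a b) true ih) l

/-- Absence of repetitions in a list of natural numbers. -/
noncomputable def distinct (l : List ℕ) : Bool :=
  List.rec true (fun b l ih => cond (mem b l) false ih) l

theorem row_eq_getD (P : Pattern) (a : ℕ) : row P a = P.getD a [] := by
  induction P generalizing a with
  | nil => rfl
  | cons r P ih =>
    cases a with
    | zero => rfl
    | succ a => exact ih a

theorem mem_iff {a : ℕ} {l : List ℕ} : mem a l = true ↔ a ∈ l := by
  induction l with
  | nil => simp [mem]
  | cons b l ih =>
    change cond (Nat.beq a b) true (mem a l) = true ↔ _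
    rw [Bool.cond_true_left, Bool.or_eq_true, ih, Nat.beq_eq, List.mem_cons]

theorem distinct_iff {l : List ℕ} : distinct l = true ↔ l.Nodup := by
  induction l with
  | nil => simp [distinct]
  | cons b l ih =>
    change cond (mem b l) false (distinct l) = true ↔ _
    rw [Bool.cond_false_left, Bool.and_eq_true, ih, List.nodup_cons, ← mem_iff,
      Bool.not_eq_true', Bool.not_eq_true]

/-- The rows `P` with `w` added to the row of `v`. -/
noncomputable def insert (P : Pattern) (v w : ℕ) : Pattern :=
  List.rec (fun _ => []) (fun r P ih v => Nat.rec ((w :: r) :: P) (fun v _ => r :: ih v) v) P v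

theorem length_insert (P : Pattern) (v w : ℕ) : (insert P v w).length = P.length := by
  induction P generalizing v with
  | nil => rfl
  | cons r P ih =>
    cases v with
    | zero => rfl
    | succ v => exact congrArg (· + 1) (ih v)

theorem mem_row_insert {P : Pattern} {v w a b : ℕ} (h : b ∈ row (insert P v w) a) :
    b ∈ row P a ∨ (a = v ∧ b = w) := by
  induction P generalizing v a with
  | nil => exact .inl h
  | cons r P ih =>
    cases v with
    | zero =>
      cases a with
      | zero => exact (List.mem_cons.1 h).symm.imp id fun h => ⟨rfl, h⟩
      | succ a => exact .inl h
    | succ v =>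
      cases a with
      | zero => exact .inl h
      | succ a => exact (ih h).imp id fun h => ⟨congrArg _ h.1, h.2⟩

/-- The pattern `P` with the edge `v w` added. -/
noncomputable def addEdge (P : Pattern) (v w : ℕ) : Pattern := insert (insert P v w) w v

/-- In `P` the vertex `v` cannot get `w` as a new neighbour: they are equal or adjacent, or `w`
has three neighbours other than `v` already. -/
noncomputable def saturated (P : Pattern) (v w : ℕ) : Bool :=
  -- Rows carry no invariant, so three entries count as three neighbours other than `v` only after
  -- this test of distinctness.
  Nat.beq v w || mem w (row P v) || (Nat.ble 3 (row P w).length && distinct (v :: row P w))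

/-- The patterns that arise from `P` when `v` gets one more neighbour. -/
noncomputable def extensions (P : Pattern) (v : ℕ) : List Pattern :=
  ((List.range P.length).filter (fun w => !saturated P v w)).map (addEdge P v) ++
    -- A new vertex is possible only while fewer than 14 are in use.
    (bif Nat.ble 14 P.length then [] else [addEdge (P ++ [[]]) v P.length])

/-! ### Checking embeddings of patterns -/

/-- The `a`-th hexadecimal digit of `π`; in this way `π` encodes a map of vertices. -/
def digit (π a : ℕ) : ℕ := Nat.land (Nat.shiftRight π (Nat.mul 4 a)) 15

/-- Whether the digits of `π` before the `k`-th are distinct from each other and from the elements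
of the set with bit mask `s`. -/
noncomputable def injects (π k s : ℕ) : Bool :=
  Nat.rec (fun _ => true) (fun a ih s =>
    cond (Nat.testBit s (digit π a)) false (ih (Nat.lor s (Nat.shiftLeft 1 (digit π a))))) k s

/-- Whether the map `π` of `{0, …, k - 1}` into the vertices of `P` preserves the adjacencies given
by the rows `Q`, the first of which belongs to the vertex `a`. -/
noncomputable def preserves (π k : ℕ) (P Q : Pattern) (a : ℕ) : Bool :=
  List.rec (fun _ => true) (fun r _ ih a =>
    cond (Nat.blt (digit π a) P.length)
      (cond (List.rec true (fun b _ ih =>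
        cond (Nat.blt b k) (cond (mem (digit π b) (row P (digit π a))) ih false) false) r)
          (ih (Nat.succ a)) false) false) Q a

/-- Whether `π` embeds the pattern `Q` into the pattern `P`. -/
noncomputable def embeds (Q : Pattern) (π : ℕ) (P : Pattern) : Bool :=
  injects π Q.length 0 && preserves π Q.length P Q 0

/-- The recursion runs downwards from `k - 1`, and `s` collects the digits already met. Avoiding the
enlarged mask is what separates the current digit from all those at smaller places, hence the
induction for arbitrary `s`. -/
theorem injects_spec {π k s : ℕ} (h : injects π k s = true) :
    (∀ a < k, s.testBit (digit π a) = false) ∧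
      ∀ a < k, ∀ b < k, digit π a = digit π b → a = b := by
  induction k generalizing s with
  | zero => simp
  | succ k ih =>
    change cond (Nat.testBit s (digit π k)) false
      (injects π k (s ||| 1 <<< digit π k)) = true at h
    rw [Bool.cond_false_left, Bool.and_eq_true, Bool.not_eq_true'] at h
    obtain ⟨h1, h2⟩ := ih h.2
    simp only [Nat.testBit_or, Nat.one_shiftLeft, Nat.testBit_two_pow, Bool.or_eq_false_iff,
      decide_eq_false_iff_not] at h1
    constructor
    · intro a ha
      rcases Nat.lt_succ_iff_lt_or_eq.1 ha with ha | rfl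
      exacts [(h1 a ha).1, h.1]
    · intro a ha b hb hab
      rcases Nat.lt_succ_iff_lt_or_eq.1 ha with ha | rfl <;>
        rcases Nat.lt_succ_iff_lt_or_eq.1 hb with hb | rfl
      · exact h2 a ha b hb hab
      · exact ((h1 a ha).2 hab.symm).elim
      · exact ((h1 b hb).2 hab).elim
      · rfl

/-- The recursion consumes the rows while the vertex number increases; the offset `n` keeps track of
the rows already consumed. -/
theorem preserves_spec {π k : ℕ} {P Q : Pattern} {n : ℕ} (h : preserves π k P Q n = true) :
    ∀ a < Q.length, digit π (n + a) < P.length ∧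
      ∀ b ∈ row Q a, b < k ∧ digit π b ∈ row P (digit π (n + a)) := by
  induction Q generalizing n with
  | nil => simp
  | cons r Q ih =>
    change cond (Nat.blt (digit π n) P.length)
      (cond (List.rec true (fun b _ ih =>
        cond (Nat.blt b k) (cond (mem (digit π b) (row P (digit π n))) ih false) false) r : Bool)
          (preserves π k P Q (n + 1)) false) false = true at h
    simp only [Bool.cond_false_right, Bool.and_eq_true, Nat.blt_eq] at h
    obtain ⟨h1, h2, h3⟩ := h
    intro a ha
    cases a with
    | zero =>
      refine ⟨h1, ?_⟩
      change ∀ b ∈ r, _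
      clear ih h3 ha
      induction r with
      | nil => simp
      | cons b r ih =>
        simp only [Bool.and_eq_true, Nat.blt_eq, mem_iff] at h2
        exact List.forall_mem_cons.2 ⟨⟨h2.1, h2.2.1⟩, ih h2.2.2⟩
    | succ a =>
      have := ih h3 a (by simpa using ha)
      rwa [show n + 1 + a = n + (a + 1) by omega] at this

/-! ### Decoding and strict evaluation -/

/-- The value of `k` at `n`, which the kernel evaluates after it has evaluated `n`. -/
noncomputable def forceNat {α : Type} (n : ℕ) (k : ℕ → α) : α :=
  Nat.rec (k 0) (fun m _ => k (Nat.succ m)) n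

/-- The pattern on `n` vertices whose edges are given by the bytes of `c`. -/
noncomputable def ofCode (n c : ℕ) : Pattern :=
  -- A cubic graph on 14 vertices has 21 edges, one byte for each.
  go 21 (List.replicate n [])
where
  go : ℕ → Pattern → Pattern
  | 0, P => P
  | i + 1, P =>
    -- The zero byte would be a loop at vertex 0, so it is free to mean that there is no edge.
    bif Nat.beq (byte i) 0 then go i P
    else forceNat (Nat.land (byte i) 15) fun v => forceNat (Nat.shiftRight (byte i) 4) fun w =>
      go i (addEdge P v w)
  byte (i : ℕ) : ℕ := Nat.land (Nat.shiftRight c (Nat.mul 8 i)) 255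

/-- The value of `k` at `l`, which the kernel evaluates after it has evaluated `l`. -/
noncomputable def forceRow {α : Type} (l : List ℕ) : (List ℕ → α) → α :=
  List.rec (fun k => k []) (fun a _ ih k => forceNat a fun a => ih fun l => k (a :: l)) l

/-- The value of `k` at `P`, which the kernel evaluates after it has evaluated `P`. -/
noncomputable def force (P : Pattern) : (Pattern → Bool) → Bool :=
  List.rec (fun k => k []) (fun r _ ih k => forceRow r fun r => ih fun P => k (r :: P)) P

/-- Matching on a number makes the kernel reduce it to a literal first; the value is unaffected, so
forcing vanishes from the proofs. -/
theorem forceNat_eq {α : Type} (n : ℕ) (k : ℕ → α) : forceNat n k = k n := by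
  cases n <;> rfl

theorem forceRow_eq {α : Type} (l : List ℕ) (k : List ℕ → α) : forceRow l k = k l := by
  induction l generalizing k with
  | nil => rfl
  | cons a l ih => exact (forceNat_eq a fun a => forceRow l fun l => k (a :: l)).trans (ih _)

theorem force_eq (P : Pattern) (k : Pattern → Bool) : force P k = k P := by
  induction P generalizing k with
  | nil => rfl
  | cons r P ih => exact (forceRow_eq r fun r => force P fun P => k (r :: P)).trans (ih _)

/-! ### Search certificates -/

/-- One step of a proof that the good cubic graphs containing a pattern are all listed. -/
inductive Step
  /-- The pattern contains, by way of `π`, the `j`-th known pattern. -/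
  | embed (j π : ℕ)
  /-- There is a further vertex. -/
  | grow
  /-- The vertex `v` has a further neighbour. -/
  | branch (v : ℕ)

/-- Whether the steps settle all the patterns in the list, given the patterns `db`. -/
noncomputable def settles (db : List Pattern) : List Step → List Pattern → Bool
  | [], [] => true
  | .embed j π :: is, P :: s =>
    match db[j]? with
    | some Q => embeds Q π P && settles db is s
    | none => false
  | .grow :: is, P :: s => Nat.blt P.length 14 && settles db is ((P ++ [[]]) :: s)
  | .branch v :: is, P :: s =>
    -- The open patterns form a stack, so the steps list a depth-first traversal of the search tree.
    Nat.blt v P.length && Nat.blt (row P v).length 3 && settles db is (extensions P v ++ s)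
  | _, _ => false

/-- Whether the successive patterns are settled, each by means of `db` and of those before it. -/
noncomputable def settlesAll : List Pattern → List (ℕ × ℕ × List Step) → Bool
  | _, [] => true
  | db, (n, c, is) :: ls =>
    force (ofCode n c) fun P => settles db is [P] && settlesAll (P :: db) ls

/-! ### Soundness of the search -/

/-- `f` embeds the pattern `P` into the graph `H`. -/
structure Realizes {W : Type*} (H : SimpleGraph W) (P : Pattern) (f : ℕ → W) : Prop where
  inj : ∀ a < P.length, ∀ b < P.length, f a = f b → a = b
  adj : ∀ a, ∀ b ∈ row P a, b < P.length ∧ H.Adj (f a) (f b)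

variable {W : Type*} {H : SimpleGraph W} {P Q : Pattern} {f : ℕ → W}

theorem lt_of_mem_row {a b : ℕ} (h : b ∈ row P a) : a < P.length := by
  by_contra hc
  simp [row_eq_getD, List.getD, List.getElem?_eq_none (not_lt.1 hc)] at h

theorem length_addEdge (v w : ℕ) : (addEdge P v w).length = P.length := by
  rw [addEdge, length_insert, length_insert]

theorem mem_row_addEdge {v w a b : ℕ} (h : b ∈ row (addEdge P v w) a) :
    b ∈ row P a ∨ (a = v ∧ b = w) ∨ (a = w ∧ b = v) := by
  rcases mem_row_insert h with h | h
  · exact (mem_row_insert h).imp id .inl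
  · exact .inr (.inr h)

theorem row_append_nil (a : ℕ) : row (P ++ [[]]) a = row P a := by
  simp only [row_eq_getD, List.getD]
  rcases lt_trichotomy a P.length with h | h | h
  · rw [List.getElem?_append_left h]
  · subst h; simp
  · rw [List.getElem?_eq_none (by simp; omega), List.getElem?_eq_none (by omega)]

theorem Realizes.addEdge (h : Realizes H P f) {v w : ℕ} (hv : v < P.length) (hw : w < P.length)
    (ha : H.Adj (f v) (f w)) : Realizes H (addEdge P v w) f where
  inj := by simpa [length_addEdge] using h.inj
  adj := by
    intro a b hb
    rw [length_addEdge]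
    rcases mem_row_addEdge hb with hb | ⟨rfl, rfl⟩ | ⟨rfl, rfl⟩
    · exact h.adj a b hb
    · exact ⟨hw, ha⟩
    · exact ⟨hv, ha.symm⟩

theorem Realizes.grow (h : Realizes H P f) {y : W} (hy : ∀ a < P.length, f a ≠ y) :
    Realizes H (P ++ [[]]) (Function.update f P.length y) where
  inj := by
    intro a ha b hb hab
    simp only [List.length_append, List.length_singleton] at ha hb
    rcases (Nat.lt_succ_iff_lt_or_eq.1 ha) with ha | rfl <;>
      rcases (Nat.lt_succ_iff_lt_or_eq.1 hb) with hb | rfl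
    · rw [Function.update_of_ne ha.ne, Function.update_of_ne hb.ne] at hab
      exact h.inj a ha b hb hab
    · rw [Function.update_of_ne ha.ne, Function.update_self] at hab
      exact (hy a ha hab).elim
    · rw [Function.update_of_ne hb.ne, Function.update_self] at hab
      exact (hy b hb hab.symm).elim
    · rfl
  adj := by
    intro a b hb
    rw [row_append_nil] at hb
    have ha := lt_of_mem_row hb
    obtain ⟨hb', hab⟩ := h.adj a b hb
    rw [Function.update_of_ne ha.ne, Function.update_of_ne hb'.ne]
    exact ⟨by simp; omega, hab⟩

/-- Since patterns only record edges, never non-edges, containment is transitive. This is what lets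
a settled pattern settle every pattern containing it. -/
theorem Realizes.comp (h : Realizes H P f) {π : ℕ} (he : embeds Q π P = true) :
    Realizes H Q (fun a => f (digit π a)) := by
  rw [embeds, Bool.and_eq_true] at he
  have hi := (injects_spec he.1).2
  have hp := preserves_spec he.2
  simp only [zero_add] at hp
  refine ⟨fun a ha b hb hab => ?_, fun a b hb => ?_⟩
  · exact hi a ha b hb (h.inj _ (hp a ha).1 _ (hp b hb).1 hab)
  · have := (hp a (lt_of_mem_row hb)).2 b hb
    exact ⟨this.1, (h.adj _ _ this.2).2⟩

/-- Every good cubic graph that contains the pattern `P` is isomorphic to some `L i`. -/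
def Forced.{u} {ι : Type} (L : ι → SimpleGraph (Fin 14)) (P : Pattern) : Prop :=
  ∀ (W : Type u) (H : SimpleGraph W) (f : ℕ → W), H.IsGoodCubic → Realizes H P f →
    ∃ i, Nonempty (H ≃g L i)

theorem _root_.SimpleGraph.IsGoodCubic.finite (hH : H.IsGoodCubic) : Finite W :=
  Nat.finite_of_card_ne_zero (by rw [hH.card]; decide)

theorem card_image_range_le (f : ℕ → W) (n : ℕ) : (f '' {a | a < n}).ncard ≤ n := by
  have := Set.ncard_image_le (f := f) (Set.finite_lt_nat n)
  rwa [show ({a | a < n} : Set ℕ).ncard = n by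
    rw [Set.ncard_eq_toFinset_card']; simp] at this

/-- Needed for the step `grow`: once all vertices of a pattern have degree three, branching cannot
reach the vertices outside it. -/
theorem exists_forall_ne (hH : H.IsGoodCubic) {n : ℕ} (hn : n < 14) (f : ℕ → W) :
    ∃ y, ∀ a < n, f a ≠ y := by
  by_contra! hc
  have := hH.finite
  have h1 : f '' {a | a < n} = Set.univ := Set.eq_univ_of_forall fun y => hc y
  have h2 := card_image_range_le f n
  rw [h1, Set.ncard_univ, hH.card] at h2
  omega

theorem Realizes.length_le (hH : H.IsGoodCubic) (h : Realizes H P f) : P.length ≤ 14 := by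
  have := hH.finite
  have h1 := Nat.card_le_card_of_injective (fun a : Fin P.length => f a)
    (fun a b hab => Fin.ext (h.inj a a.2 b b.2 hab))
  simpa [hH.card] using h1

/-- The images of distinct neighbours in a pattern. -/
theorem Realizes.ncard_image_row (h : Realizes H P f) {a : ℕ} (hd : (row P a).Nodup) :
    (f '' {b | b ∈ row P a}).ncard = (row P a).length := by
  have hi : Set.InjOn f {b | b ∈ row P a} := fun b hb c hc hbc =>
    h.inj b (h.adj a b hb).1 c (h.adj a c hc).1 hbc
  rw [hi.ncard_image]
  rw [← List.toFinset_card_of_nodup hd, ← Set.ncard_coe_finset]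
  congr 1
  ext; simp

theorem Realizes.image_row_subset (h : Realizes H P f) (a : ℕ) :
    f '' {b | b ∈ row P a} ⊆ H.neighborSet (f a) := by
  rintro _ ⟨b, hb, rfl⟩
  exact (h.adj a b hb).2

/-- If three distinct neighbours of `a` are in the pattern, there is no other. -/
theorem Realizes.image_row_eq (hH : H.IsGoodCubic) (h : Realizes H P f) {a : ℕ}
    (hd : (row P a).Nodup) (h3 : 3 ≤ (row P a).length) :
    f '' {b | b ∈ row P a} = H.neighborSet (f a) := by
  have := hH.finite
  refine Set.eq_of_subset_of_ncard_le (h.image_row_subset a) ?_ (Set.toFinite _)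
  rw [hH.cubic, h.ncard_image_row hd]
  exact h3

/-- The branching principle. Three neighbours exist in `H` and fewer than three are recorded, so one
is unrecorded; it is the image of a pattern vertex with room for another neighbour, or it lies
outside the image. -/
theorem Realizes.exists_extension (hH : H.IsGoodCubic) (h : Realizes H P f) {v : ℕ}
    (hv : v < P.length) (h3 : (row P v).length < 3) :
    ∃ Q ∈ extensions P v, ∃ g, Realizes H Q g := by
  have := hH.finite
  obtain ⟨y, hy, hyn⟩ : ∃ y ∈ H.neighborSet (f v), y ∉ f '' {b | b ∈ row P v} := by
    by_contra! hc
    have h1 := Set.ncard_le_ncard (t := f '' {b | b ∈ row P v}) hc (Set.toFinite _)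
    rw [hH.cubic] at h1
    -- The row may contain repetitions, so its length is only an upper bound for the number of
    -- recorded neighbours; that is the direction needed.
    have h2 : (f '' {b | b ∈ row P v}).ncard ≤ (row P v).toFinset.card := by
      rw [← Set.ncard_coe_finset]
      refine (Set.ncard_image_le (row P v).finite_toSet).trans_eq ?_
      congr 1; ext; simp
    have h3 := (row P v).toFinset_card_le
    omega
  rw [SimpleGraph.mem_neighborSet] at hy
  by_cases hw : ∃ w < P.length, f w = y
  · obtain ⟨w, hw, rfl⟩ := hw
    refine ⟨Pattern.addEdge P v w, ?_, f, h.addEdge hv hw hy⟩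
    refine List.mem_append_left _ (List.mem_map_of_mem
      (List.mem_filter.2 ⟨List.mem_range.2 hw, ?_⟩))
    rw [Bool.not_eq_true', Bool.eq_false_iff]
    intro hs
    simp only [saturated, Bool.or_eq_true, Bool.and_eq_true, mem_iff, distinct_iff,
      Nat.beq_eq, Nat.ble_eq, List.nodup_cons] at hs
    rcases hs with (rfl | hs) | ⟨hs, hvw, hd⟩
    · exact H.loopless.irrefl _ hy
    · exact hyn ⟨w, hs, rfl⟩
    · have h4 : f v ∈ f '' {b | b ∈ row P w} := by
        rw [h.image_row_eq hH hd hs]; exact hy.symm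
      obtain ⟨b, hb, hbv⟩ := h4
      have := h.inj b (h.adj w b hb).1 v hv hbv
      subst this
      exact hvw hb
  · push Not at hw
    -- A pattern on 14 vertices covers all of `H`, which leaves no room for `y`.
    have hlen : P.length < 14 := by
      by_contra hc
      have hl := h.length_le hH
      have hb : Function.Bijective (fun a : Fin P.length => f a) :=
        (Nat.bijective_iff_injective_and_card _).2
          ⟨fun a b hab => Fin.ext (h.inj a a.2 b b.2 hab), by simp [hH.card]; omega⟩
      obtain ⟨a, ha⟩ := hb.2 y
      exact hw a a.2 ha
    refine ⟨_, ?_, _, (h.grow hw).addEdge (v := v) (w := P.length) (by simp; omega) (by simp) ?_⟩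
    · refine List.mem_append_right _ ?_
      rw [show Nat.ble 14 P.length = false by rw [Bool.eq_false_iff]; simpa using hlen]
      simp
    · rwa [Function.update_of_ne hv.ne, Function.update_self]

variable {ι : Type} {L : ι → SimpleGraph (Fin 14)}

/-- Induction along the certificate, for all open patterns at once. An `embed` closes the top
pattern by a known one, a `grow` enlarges it, and a `branch` replaces it by its extensions, of which
at least one is realized in `H`. -/
theorem forced_of_settles.{u} {db : List Pattern} (hdb : ∀ Q ∈ db, Forced.{u} L Q) :
    ∀ (is : List Step) (s : List Pattern), settles db is s = true → ∀ P ∈ s, Forced.{u} L P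
  | [], [], _ => by simp
  | [], _ :: _, h => by simp [settles] at h
  | .embed _ _ :: _, [], h => by simp [settles] at h
  | .grow :: _, [], h => by simp [settles] at h
  | .branch _ :: _, [], h => by simp [settles] at h
  | .embed j π :: is, P :: s, h => by
    simp only [settles] at h
    cases hQ : db[j]? with
    | none => simp [hQ] at h
    | some Q =>
      simp only [hQ, Bool.and_eq_true] at h
      refine List.forall_mem_cons.2 ⟨?_, forced_of_settles hdb is s h.2⟩
      intro W H f hH hf
      exact hdb Q (List.mem_of_getElem? hQ) W H _ hH (hf.comp h.1)
  | .grow :: is, P :: s, h => by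
    simp only [settles, Bool.and_eq_true, Nat.blt_eq] at h
    have ih := List.forall_mem_cons.1 (forced_of_settles hdb is _ h.2)
    refine List.forall_mem_cons.2 ⟨?_, ih.2⟩
    intro W H f hH hf
    obtain ⟨y, hy⟩ := exists_forall_ne hH h.1 f
    exact ih.1 W H _ hH (hf.grow hy)
  | .branch v :: is, P :: s, h => by
    simp only [settles, Bool.and_eq_true, Nat.blt_eq] at h
    have ih := List.forall_mem_append.1 (forced_of_settles hdb is _ h.2)
    refine List.forall_mem_cons.2 ⟨?_, ih.2⟩
    intro W H f hH hf
    obtain ⟨Q, hQ, g, hg⟩ := hf.exists_extension hH h.1.1 h.1.2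
    exact ih.1 Q hQ W H g hH hg

/-- Every settled pattern joins the known ones, so later certificates may cite it. -/
theorem forced_of_settlesAll.{u} : ∀ (ls : List (ℕ × ℕ × List Step)) (db : List Pattern),
    (∀ Q ∈ db, Forced.{u} L Q) → settlesAll db ls = true → ∀ l ∈ ls, Forced.{u} L (ofCode l.1 l.2.1)
  | [], _, _, _ => by simp
  | (n, c, is) :: ls, db, hdb, h => by
    simp only [settlesAll, force_eq, Bool.and_eq_true] at h
    have hP : Forced.{u} L (ofCode n c) := forced_of_settles hdb is _ h.1 _ (by simp)
    exact List.forall_mem_cons.2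
      ⟨hP, forced_of_settlesAll ls (_ :: db) (List.forall_mem_cons.2 ⟨hP, hdb⟩) h.2⟩

/-! ### The graphs and the search data -/

/-- The connected good cubic graphs. -/
def connectedList : List Pattern := [
  [[1,2,3], [0,2,4], [0,1,5], [0,6,7], [1,6,8], [2,6,9], [3,4,5], [3,10,11], [4,10,12], [5,10,13],
  [7,8,9], [7,12,13], [8,11,13], [9,11,12]],
  [[1,2,3], [0,2,4], [0,1,5], [0,6,7], [1,6,8], [2,6,9], [3,4,5], [3,10,11], [4,10,12], [5,12,13],
  [7,8,11], [7,10,13], [8,9,13], [9,11,12]],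
  [[1,2,3], [0,2,4], [0,1,5], [0,6,7], [1,6,8], [2,10,11], [3,4,7], [3,6,9], [4,10,12], [7,12,13],
  [5,8,11], [5,10,13], [8,9,13], [9,11,12]],
  [[1,2,3], [0,2,4], [0,1,5], [0,6,7], [1,6,8], [2,10,11], [3,4,7], [3,6,9], [4,10,12], [7,11,13],
  [5,8,12], [5,9,13], [8,10,13], [9,11,12]],
  [[1,2,3], [0,2,4], [0,1,5], [0,6,7], [1,6,8], [2,9,11], [3,4,9], [3,10,12], [4,10,13], [5,6,10],
  [7,8,9], [5,12,13], [7,11,13], [8,11,12]],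
  [[1,2,3], [0,2,4], [0,1,5], [0,6,7], [1,6,8], [2,9,11], [3,4,9], [3,8,10], [4,7,13], [5,6,10],
  [7,9,12], [5,12,13], [10,11,13], [8,11,12]],
  [[1,2,3], [0,2,4], [0,1,5], [0,6,7], [1,6,8], [2,9,11], [3,4,9], [3,10,11], [4,12,13], [5,6,10],
  [7,9,12], [5,7,13], [8,10,13], [8,11,12]],
  [[1,2,3], [0,2,4], [0,1,5], [0,6,7], [1,6,8], [2,9,11], [3,4,9], [3,10,12], [4,11,13], [5,6,10],
  [7,9,12], [5,8,13], [7,10,13], [8,11,12]],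
  [[1,2,3], [0,2,4], [0,1,5], [0,6,7], [1,6,8], [2,9,11], [3,4,9], [3,8,11], [4,7,12], [5,6,10],
  [9,12,13], [5,7,13], [8,10,13], [10,11,12]],
  [[1,2,3], [0,2,4], [0,1,5], [0,6,7], [1,6,8], [2,9,11], [3,4,9], [3,11,12], [4,11,13], [5,6,10],
  [9,12,13], [5,7,8], [7,10,13], [8,10,12]],
  [[1,2,3], [0,2,4], [0,1,5], [0,6,7], [1,6,8], [2,7,10], [3,4,9], [3,5,12], [4,12,13], [6,10,11],
  [5,9,11], [9,10,13], [7,8,13], [8,11,12]],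
  [[1,2,3], [0,2,4], [0,1,5], [0,6,7], [1,6,8], [2,7,12], [3,4,9], [3,5,10], [4,12,13], [6,10,11],
  [7,9,11], [9,10,13], [5,8,13], [8,11,12]],
  [[1,2,3], [0,2,4], [0,1,5], [0,6,7], [1,6,8], [2,10,12], [3,4,9], [3,11,13], [4,12,13],
  [6,10,11], [5,9,11], [7,9,10], [5,8,13], [7,8,12]],
  [[1,2,3], [0,2,4], [0,1,5], [0,6,7], [1,6,8], [2,10,12], [3,4,9], [3,11,13], [4,12,13],
  [6,10,11], [5,9,13], [7,9,12], [5,8,11], [7,8,10]],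
  [[1,2,3], [0,2,4], [0,1,5], [0,6,7], [1,6,8], [2,12,13], [3,4,9], [3,8,10], [4,7,11], [6,10,11],
  [7,9,12], [8,9,13], [5,10,13], [5,11,12]],
  [[1,2,3], [0,2,4], [0,1,5], [0,6,7], [1,6,8], [2,12,13], [3,4,9], [3,8,10], [4,7,12], [6,10,11],
  [7,9,11], [9,10,13], [5,8,13], [5,11,12]],
  [[1,2,3], [0,2,4], [0,1,5], [0,6,7], [1,6,8], [2,12,13], [3,4,9], [3,8,12], [4,7,13], [6,10,11],
  [9,11,12], [9,10,13], [5,7,10], [5,8,11]],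
  [[1,2,3], [0,2,4], [0,1,5], [0,6,7], [1,6,8], [2,12,13], [3,4,9], [3,10,12], [4,11,13],
  [6,10,11], [7,9,12], [8,9,13], [5,7,10], [5,8,11]],
  [[1,2,3], [0,2,4], [0,1,5], [0,6,7], [1,6,8], [2,12,13], [3,4,9], [3,10,12], [4,11,13],
  [6,10,11], [7,9,13], [8,9,12], [5,7,11], [5,8,10]],
  [[1,2,3], [0,2,4], [0,1,5], [0,6,7], [1,8,9], [2,10,11], [3,7,8], [3,6,12], [4,6,10], [4,12,13],
  [5,8,11], [5,10,13], [7,9,13], [9,11,12]],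
  [[1,2,3], [0,2,4], [0,1,5], [0,6,7], [1,8,9], [2,10,11], [3,7,12], [3,6,13], [4,9,12], [4,8,13],
  [5,11,12], [5,10,13], [6,8,10], [7,9,11]],
  [[1,2,3], [0,2,4], [0,1,5], [0,6,7], [1,8,9], [2,10,11], [3,7,12], [3,6,13], [4,11,12],
  [4,10,13], [5,9,12], [5,8,13], [6,8,10], [7,9,11]],
  [[1,2,3], [0,2,4], [0,1,5], [0,6,7], [1,8,9], [2,10,11], [3,8,10], [3,12,13], [4,6,11],
  [4,10,12], [5,6,9], [5,8,13], [7,9,13], [7,11,12]],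
  [[1,2,3], [0,2,4], [0,1,5], [0,6,7], [1,8,9], [2,10,11], [3,8,10], [3,9,13], [4,6,12], [4,7,11],
  [5,6,13], [5,9,12], [8,11,13], [7,10,12]],
  [[1,2,3], [0,2,4], [0,1,5], [0,6,7], [1,8,9], [2,10,11], [3,8,10], [3,9,11], [4,6,12], [4,7,13],
  [5,6,13], [5,7,12], [8,11,13], [9,10,12]],
  [[1,2,3], [0,2,4], [0,1,5], [0,6,7], [1,8,9], [2,10,11], [3,8,10], [3,12,13], [4,6,12],
  [4,11,13], [5,6,13], [5,9,12], [7,8,11], [7,9,10]],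
  [[1,2,3], [0,2,4], [0,1,5], [0,6,7], [1,8,9], [2,10,11], [3,8,12], [3,10,13], [4,6,13],
  [4,11,12], [5,7,12], [5,9,13], [6,9,10], [7,8,11]],
  [[1,2,3], [0,4,5], [0,6,7], [0,8,9], [1,6,8], [1,7,12], [2,4,10], [2,5,13], [3,4,11], [3,10,12],
  [6,9,13], [8,12,13], [5,9,11], [7,10,11]],
  [[1,2,3], [0,4,5], [0,6,7], [0,8,9], [1,6,8], [1,7,12], [2,4,10], [2,5,13], [3,4,11], [3,10,13],
  [6,9,12], [8,12,13], [5,10,11], [7,9,11]],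
  [[1,2,3], [0,4,5], [0,6,7], [0,8,9], [1,6,8], [1,7,12], [2,4,10], [2,5,13], [3,4,11], [3,12,13],
  [6,11,13], [8,10,12], [5,9,11], [7,9,10]],
  [[1,2,3], [0,4,5], [0,6,7], [0,8,9], [1,6,8], [1,12,13], [2,4,10], [2,9,12], [3,4,11], [3,7,13],
  [6,11,12], [8,10,13], [5,7,10], [5,9,11]],
  [[1,2,3], [0,4,5], [0,6,7], [0,8,9], [1,6,8], [1,12,13], [2,4,10], [2,9,12], [3,4,11], [3,7,13],
  [6,11,13], [8,10,12], [5,7,11], [5,9,10]],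
  [[1,2,3], [0,4,5], [0,6,7], [0,8,9], [1,6,8], [1,12,13], [2,4,10], [2,11,12], [3,4,11],
  [3,10,12], [6,9,13], [7,8,13], [5,7,9], [5,10,11]],
  [[1,2,3], [0,4,5], [0,6,7], [0,8,9], [1,6,10], [1,9,12], [2,4,11], [2,8,13], [3,7,10], [3,5,11],
  [4,8,12], [6,9,13], [5,10,13], [7,11,12]],
  [[1,2,3], [0,4,5], [0,6,7], [0,8,9], [1,6,10], [1,9,13], [2,4,11], [2,8,13], [3,7,10], [3,5,11],
  [4,8,12], [6,9,12], [10,11,13], [5,7,12]],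
  [[1,2,3], [0,4,5], [0,6,7], [0,8,9], [1,10,11], [1,12,13], [2,10,12], [2,11,13], [3,10,13],
  [3,11,12], [4,6,8], [4,7,9], [5,6,9], [5,7,8]]]

/-- The connected cubic graphs on ten vertices without a cycle of length four;
the last one is the Petersen graph. -/
def tenList : List Pattern := [
  [[1,2,3], [0,2,4], [0,1,5], [0,6,7], [1,6,8], [2,6,9], [3,4,5], [3,8,9], [4,7,9], [5,7,8]],
  [[1,2,3], [0,2,4], [0,1,5], [0,6,7], [1,6,8], [2,8,9], [3,4,7], [3,6,9], [4,5,9], [5,7,8]],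
  [[1,2,3], [0,4,5], [0,6,7], [0,8,9], [1,6,8], [1,7,9], [2,4,9], [2,5,8], [3,4,7], [3,5,6]]]

/-- Patterns with the steps that settle them, part 1. -/
def searchList1 : List (ℕ × ℕ × List Step) := [
  -- In `embed j` the index counts back from the pattern settled last. At this first entry 0 is
  -- `banner` and 1 to 39 are the good graphs; each further entry shifts them by one.
  (13, 0xc9b8a9a898767574656454323130212010,
   [.branch 10, .embed 0 0xcab89, .embed 0 0xbac98, .branch 11, .embed 0 0xabc98, .embed 0 0x9bda8]),
  (12, 0xb8a9a898767574656454323130212010,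
   [.branch 9, .branch 10, .grow, .branch 12, .branch 12, .embed 1 0xc9b8a,
    .embed 0 0xcba9876543210]),
  (14, 0xd9cbc8b7a9a8a7968574656454323130212010,
   [.branch 11, .branch 12, .embed 39 0xdcba9876543210]),
  (14, 0xd9c8b7a9a8a7968574656454323130212010,
   [.branch 11, .embed 0 0xdcba9876543210, .embed 0 0xcdba8975643210]),
  (14, 0xdbd9c9c8bab7a8a7968574656454323130212010,
   [.branch 12, .embed 42 0xdcba9876543210]),
  (13, 0xc8bab7a8a7968574656454323130212010,
   [.branch 11, .branch 9, .branch 12, .branch 13, .branch 12, .branch 12, .embed 5 0x5cba8,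
    .branch 9, .branch 9, .embed 0 0xdcba9876543210, .branch 9, .embed 0 0xdcba9876543210]),
  (13, 0xc8b7a8a7968574656454323130212010,
   [.branch 10, .branch 9, .embed 6 0x4b9a7, .embed 6 0x5c9a8, .embed 2 0xdcba9876543210,
    .embed 0 0xcba9876543210, .embed 0 0xbca9786453210, .branch 13, .branch 13, .embed 6 0x4bda7,
    .embed 6 0x5cda8, .embed 6 0x4bda7, .embed 6 0x5cda8]),
  (12, 0xb7a8a7968574656454323130212010,
   [.branch 8, .embed 7 0x48965, .embed 7 0x4b8a7, .embed 0 0xcba9876543210]),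
  (9, 0x8574656454323130212010,
   [.branch 6, .embed 8 0x86745, .embed 8 0x76854, .branch 7, .embed 8 0x67854, .embed 8 0x57964,
    .branch 7, .embed 8 0x67854, .embed 8 0x57964, .branch 8, .embed 8 0x48965,
    .embed 0 0xba9876543210, .embed 0 0xab9876543210, .branch 8, .embed 8 0x48965,
    .embed 1 0xcba9876543210, .embed 1 0xcab9876543210, .branch 9, .embed 0 0xba8975643210,
    .embed 0 0xab8975643210, .embed 0 0xdc7984653210, .embed 0 0xcd7984653210]),
  (8, 0x74656454323130212010,
   [.branch 5, .branch 6, .grow, .branch 8, .branch 8, .branch 8, .branch 9,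
    .embed 7 0xba9876543210, .embed 7 0xab9876543210, .branch 9, .embed 8 0xcba9876543210,
    .embed 8 0xcab9876543210, .branch 10, .embed 7 0x9ba876543210, .embed 9 0xbac98,
    .embed 9 0xbad98, .embed 9 0x85746, .embed 0 0x876543210]),
  (14, 0xd7c8c7b6a8a69585746454323130212010,
   [.branch 10, .embed 10 0x49a85, .embed 1 0x84ba63210, .embed 6 0xdb94765ca83210, .branch 12,
    .embed 10 0x49c85, .branch 11, .branch 9, .embed 49 0xdcba9876543210, .embed 10 0x4bda6,
    .embed 10 0x5cda8]),
  (14, 0xd7c7b6a8a69585746454323130212010,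
   [.branch 8, .embed 2 0xa49853210, .embed 11 0x4b8a6, .embed 0 0xdcba9876543210,
    .embed 0 0xcdba9876543210]),
  -- Two triangles sharing an edge. Either the missing edge is present, giving K₄, and the search
  -- goes on among the other ten vertices, or a pendant edge completes a `banner`.
  (4, 0x3130212010,
   [.branch 2, .grow, .branch 4, .branch 4, .branch 4, .branch 5, .embed 2 0x76543210,
    .embed 2 0x67543210, .branch 5, .embed 3 0x876543210, .embed 3 0x867543210, .branch 6,
    .embed 2 0x57643210, .embed 12 0x76854, .embed 12 0x76954, .branch 6, .embed 3 0xa57643210,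
    .embed 12 0x76854, .embed 12 0x76954, .branch 7, .embed 12 0x67854, .embed 12 0x67954,
    .embed 12 0x57a64, .embed 12 0x57b64, .branch 7, .embed 12 0x67854, .embed 12 0x67954,
    .embed 12 0x57a64, .embed 12 0x57b64, .branch 8, .embed 2 0x49853210,
    .embed 0 0xdcba9876543210, .embed 0 0xdcab9876543210, .embed 0 0xbadc9867543210,
    .embed 0 0xbacd9867543210, .embed 12 0x41302]),
  (14, 0xdacbcaba989795878473656463524130212010,
   [.branch 11, .embed 0 0xdcba]),
  (13, 0xcabab9a89795878473656463524130212010,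
   [.branch 11, .branch 12, .branch 13, .branch 12, .embed 14 0x8cdba]),
  (14, 0xdacbcab9a89795878473656463524130212010,
   [.branch 11, .embed 15 0x8dbca]),
  (12, 0xb9a89795878473656463524130212010,
   [.branch 10, .branch 10, .embed 1 0xcba9876543210, .branch 10, .embed 1 0xcba9876543210,
    .branch 11, .embed 0 0xdcba9876543210, .embed 0 0xcdba9876543210]),
  (11, 0xa89795878473656463524130212010,
   [.branch 9, .embed 17 0x39a87, .embed 0 0xba9876543210]),
  (12, 0xb9a9a8a795878473656463524130212010,
   [.branch 11, .branch 11, .branch 12, .branch 12]),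
  -- No vertex can become a further neighbour of 13, so there are no extensions: a contradictory
  -- pattern closed by branching alone.
  (14, 0xdccbc9bab9a8a795878473656463524130212010,
   [.branch 13]),
  (13, 0xc9bab9a8a795878473656463524130212010,
   [.branch 11, .branch 12, .embed 0 0xdcba9876543210, .branch 12, .embed 20 0x5cdb9]),
  (14, 0xd9cbc9baa8a795878473656463524130212010,
   [.branch 11, .embed 21 0x5dbc9]),
  (12, 0xbaa8a795878473656463524130212010,
   [.branch 9, .branch 9, .embed 1 0xcba9876543210, .branch 9, .embed 1 0xcba9876543210,
    .branch 11, .embed 0 0xdcba9876543210, .embed 0 0xcdba9876543210]),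
  (13, 0xcab8a9a795878473656463524130212010,
   [.branch 9, .branch 11, .embed 23 0x5bca9, .branch 12, .branch 12, .branch 12, .branch 11,
    .branch 13, .branch 11, .branch 11, .branch 12, .branch 12, .embed 23 0x5dca9,
    .embed 23 0x5dca9]),
  (12, 0xb8a9a795878473656463524130212010,
   [.branch 10, .embed 24 0x3ab87, .embed 0 0xcba9876543210]),
  (14, 0xdacac9b8a795878473656463524130212010,
   [.branch 9, .embed 0 0xab9786534201, .embed 25 0x5dac9]),
  (11, 0xa795878473656463524130212010,
   [.branch 8, .embed 8 0xa9786534201, .branch 10, .branch 9, .embed 7 0xba9876543210,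
    .embed 3 0xba9876543210, .branch 10, .embed 1 0xba9876543210, .embed 26 0x3ab87, .branch 10,
    .embed 2 0xcba9876543210, .embed 26 0x3ab87, .branch 9, .embed 1 0xab9786534201,
    .embed 0 0xdcba9876543210, .embed 0 0xcdba9876543210]),
  (10, 0x95878473656463524130212010,
   [.branch 7, .branch 8, .grow, .branch 10, .branch 10, .branch 10, .branch 11,
    .embed 13 0xdcba9876543210, .embed 13 0xcdba9876543210, .embed 9 0xa9876543210,
    .embed 0 0xa9876543210]),
  (14, 0xd9cbc8b7a9a8a7958473656463524130212010,
   [.branch 11, .branch 12, .embed 29 0xdcba9876543210]),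
  (14, 0xdbd9c9c8bab7a8a7958473656463524130212010,
   [.branch 12, .embed 31 0xdcba9876543210]),
  (13, 0xc8bab7a8a7958473656463524130212010,
   [.branch 11, .branch 9, .branch 12, .branch 13, .branch 12, .branch 12, .embed 30 0x4cba8,
    .branch 9, .branch 9, .embed 0 0xdcba9876543210, .branch 9, .embed 0 0xdcba9876543210]),
  (13, 0xc8b7a8a7958473656463524130212010,
   [.branch 10, .branch 9, .embed 31 0x3b9a7, .embed 31 0x4c9a8, .branch 11,
    .embed 2 0xdcba9876543210, .embed 2 0xcdba8976453120, .embed 0 0xcba9876543210,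
    .embed 0 0xbca9786534201, .branch 13, .branch 13, .embed 31 0x3bda7, .embed 31 0x4cda8,
    .embed 31 0x3bda7, .embed 31 0x4cda8]),
  (12, 0xb7a8a7958473656463524130212010,
   [.branch 8, .embed 5 0xa7986354021, .embed 32 0x3b8a7, .embed 0 0xcba9876543210]),
  (10, 0x958473656463524130212010,
   [.branch 7, .embed 5 0x9876543210, .embed 5 0x8976453120, .branch 7, .embed 6 0xa9876543210,
    .embed 6 0xa8976453120, .branch 8, .embed 5 0x7986354021, .embed 0 0xba9876543210,
    .embed 0 0xab9876543210, .branch 8, .embed 6 0xc7986354021, .embed 1 0xcba9876543210,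
    .embed 1 0xcab9876543210, .branch 9, .embed 0 0xba8976453120, .embed 0 0xab8976453120,
    .embed 0 0xdc7986354021, .embed 0 0xcd7986354021]),
  (13, 0xcabab9a99885847675736463524130212010,
   [.branch 11, .embed 34 0x8bca9, .branch 12, .embed 34 0x9cdba]),
  (12, 0xb9a99885847675736463524130212010,
   [.branch 10, .branch 10, .embed 0 0xcba9876543210, .branch 10, .embed 0 0xcba9876543210,
    .branch 11, .embed 35 0x8bca9, .embed 35 0x8bda9]),
  (14, 0xdacbcab9a89895847675736463524130212010,
   [.branch 11, .embed 36 0x8dbca]),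
  (11, 0xa89895847675736463524130212010,
   [.branch 9, .branch 10, .branch 11, .branch 11, .branch 12, .branch 12, .branch 10,
    .embed 37 0x4ab98, .branch 10, .embed 37 0x4ab98, .branch 11, .embed 0 0xdcba9876543210,
    .embed 0 0xcdba9876543210]),
  (13, 0xc9bab8a9a895847675736463524130212010,
   [.branch 11, .embed 38 0x5cba9, .branch 12, .branch 12]),
  (13, 0xc9b8a9a895847675736463524130212010,
   [.branch 10, .embed 0 0xcba9876543210, .embed 0 0xbca8967453120, .branch 13, .embed 39 0x4bda8,
    .embed 39 0x5cda9])]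

/-- Patterns with the steps that settle them, part 2. -/
def searchList2 : List (ℕ × ℕ × List Step) := [
  (12, 0xb8a9a895847675736463524130212010,
   [.branch 9, .embed 40 0x4b9a8, .embed 0 0xcba9876543210]),
  (14, 0xd9cac9bab8a895847675736463524130212010,
   [.branch 11, .embed 41 0x4bca8, .branch 12, .embed 41 0x8cdba]),
  (14, 0xd9cac9b8a895847675736463524130212010,
   [.branch 10, .embed 0 0xdcba9876543210, .embed 42 0x5dac9]),
  (14, 0xdacbcaba989795858476736463524130212010,
   [.branch 11, .embed 30 0xdcba]),
  (13, 0xcabab9a89795858476736463524130212010,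
   [.branch 11, .branch 12, .branch 13, .branch 12, .embed 44 0x8cdba]),
  (14, 0xdacbcab9a89795858476736463524130212010,
   [.branch 11, .embed 45 0x8dbca]),
  (10, 0x9795858476736463524130212010,
   [.branch 8, .grow, .branch 10, .branch 10, .branch 10, .branch 11, .embed 2 0xdcba9876543210,
    .embed 2 0xcdba9876543210, .branch 9, .embed 46 0x29a85, .branch 10, .branch 10,
    .embed 1 0xcba9876543210, .branch 10, .embed 1 0xcba9876543210, .branch 11,
    .embed 0 0xdcba9876543210, .embed 0 0xcdba9876543210]),
  (13, 0xcabab9a59897858476736463524130212010,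
   [.branch 11, .branch 12, .branch 13, .branch 12, .embed 47 0x5cdba]),
  (14, 0xdacbcab9a59897858476736463524130212010,
   [.branch 11, .embed 48 0x5dbca]),
  (12, 0xb9a59897858476736463524130212010,
   [.branch 10, .branch 10, .embed 1 0xcba9876543210, .branch 10, .embed 1 0xcba9876543210,
    .branch 11, .embed 0 0xdcba9876543210, .embed 0 0xcdba9876543210]),
  (13, 0xc9bab9a8a597858476736463524130212010,
   [.branch 11, .branch 12, .branch 13, .branch 12, .embed 50 0x7cdb9]),
  (14, 0xd9cbc9baa8a597858476736463524130212010,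
   [.branch 11, .embed 51 0x7dbc9]),
  (14, 0xdbcbcac9b8a9a597858476736463524130212010,
   [.branch 13]),
  (13, 0xcab8a9a597858476736463524130212010,
   [.branch 9, .branch 11, .embed 53 0x7bca9, .branch 12, .branch 12, .branch 12, .branch 11,
    .embed 0 0xdcba9876543210, .branch 11, .branch 11, .branch 12, .branch 12, .embed 53 0x7dca9,
    .embed 53 0x7dca9]),
  (14, 0xdacbcac9b9b8a597858476736463524130212010,
   [.branch 13]),
  (14, 0xdacac9b9b8a597858476736463524130212010,
   [.branch 11, .embed 0 0xdcba9876543210, .branch 12, .embed 55 0x7cdb9]),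
  (14, 0xdacac9b8a597858476736463524130212010,
   [.branch 9, .embed 0 0xdcba9876543210, .embed 56 0x7dac9]),
  (11, 0xa597858476736463524130212010,
   [.branch 8, .branch 9, .embed 57 0x2a985, .embed 7 0xba9876543210, .branch 10, .branch 9,
    .branch 11, .branch 11, .branch 12, .branch 12, .branch 9, .branch 9, .embed 6 0xcba9876543210,
    .branch 9, .embed 6 0xcba9876543210, .branch 11, .embed 5 0xdcba9876543210,
    .embed 5 0xcdba9876543210, .branch 10, .branch 10, .embed 57 0x2ab85, .embed 3 0xcba9876543210,
    .embed 57 0x2ab85, .branch 10, .embed 3 0xcba9876543210, .embed 57 0x2ab85, .branch 9,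
    .branch 9, .embed 1 0xdcba9876543210, .embed 1 0xcdba9876543210, .embed 0 0xdcba9876543210,
    .embed 0 0xcdba9876543210]),
  (10, 0x97858476736463524130212010,
   [.branch 5, .embed 11 0x9876543210, .embed 0 0xa9876543210]),
  (12, 0xb8a9a8a597958476736463524130212010,
   [.branch 11, .branch 11, .branch 12, .branch 12]),
  (13, 0xc8bab8a9a597958476736463524130212010,
   [.branch 11, .branch 12, .branch 13, .branch 12, .embed 60 0x4cdb8]),
  (14, 0xd8cbc8baa9a597958476736463524130212010,
   [.branch 11, .embed 61 0x4dbc8]),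
  (14, 0xdbcbcac8b9a8a597958476736463524130212010,
   [.branch 13]),
  (13, 0xcab9a8a597958476736463524130212010,
   [.branch 8, .branch 11, .embed 63 0x4bca8, .branch 12, .branch 12, .branch 12, .branch 11,
    .embed 0 0xdcba9876543210, .branch 11, .branch 11, .branch 12, .branch 12, .embed 63 0x4dca8,
    .embed 63 0x4dca8]),
  (12, 0xb9a8a597958476736463524130212010,
   [.branch 10, .embed 64 0x2ab95, .embed 0 0xcba9876543210]),
  (14, 0xdacac8b9a597958476736463524130212010,
   [.branch 8, .embed 0 0xab5821940763, .embed 65 0x4dac8]),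
  (11, 0xa597958476736463524130212010,
   [.branch 9, .embed 19 0x5821940763, .branch 10, .branch 8, .embed 6 0xba9876543210, .branch 8,
    .branch 8, .embed 5 0xcba9876543210, .branch 8, .embed 5 0xcba9876543210, .branch 11,
    .embed 4 0xdcba9876543210, .embed 4 0xcdba9876543210, .branch 10, .embed 1 0xba9876543210,
    .embed 66 0x2ab95, .branch 10, .embed 2 0xcba9876543210, .embed 66 0x2ab95, .branch 8,
    .embed 1 0xab5821940763, .embed 0 0xdcba9876543210, .embed 0 0xcdba9876543210]),
  (14, 0xdbd9cbc8b5a9a8a5978476736463524130212010,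
   [.branch 12, .embed 69 0x3601742a985dcb]),
  (14, 0xdbd9c9c8bab5a8a5978476736463524130212010,
   [.branch 12, .embed 71 0xdcba9876543210]),
  (14, 0xdcd9cac8b9b5a8a5978476736463524130212010,
   [.branch 11, .embed 73 0xdcba9876543210]),
  (13, 0xc8b5a8a5978476736463524130212010,
   [.branch 10, .branch 9, .embed 70 0x2b9a5, .embed 70 0x4c9a8, .branch 11, .branch 11,
    .embed 2 0xdcba9876543210, .branch 11, .embed 2 0xdcba9876543210, .branch 11, .branch 9,
    .branch 12, .branch 13, .branch 12, .branch 12, .embed 70 0x4cba8, .branch 9, .branch 9,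
    .embed 1 0xdcba9876543210, .branch 9, .embed 1 0xdcba9876543210, .branch 12, .branch 9,
    .branch 11, .branch 13, .branch 11, .branch 11, .embed 70 0x2bca5, .branch 9, .branch 9,
    .embed 0 0xdcba9876543210, .branch 9, .embed 0 0xdcba9876543210, .branch 13, .branch 13,
    .embed 70 0x2bda5, .embed 70 0x4cda8, .embed 70 0x2bda5, .embed 70 0x4cda8]),
  (12, 0xb5a8a5978476736463524130212010,
   [.branch 8, .embed 12 0x5821940763, .embed 71 0x2b8a5, .embed 0 0xcba9876543210]),
  (14, 0xd8c8b5a9a5978476736463524130212010,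
   [.branch 9, .embed 72 0x2b9a5, .embed 1 0xdac5821940763, .embed 1 0xcad5821940763]),
  (14, 0xd8c9c8b5a5978476736463524130212010,
   [.branch 9, .embed 2 0xdac5821940763, .embed 2 0xdbc5821940763, .embed 73 0x4d9c8]),
  (9, 0x8476736463524130212010,
   [.branch 7, .branch 5, .branch 8, .branch 9, .branch 9, .embed 38 0xba9876543210, .branch 8,
    .branch 8, .embed 36 0xa9876543210, .branch 8, .embed 36 0xa9876543210, .branch 9,
    .embed 33 0xba9876543210, .embed 33 0xab9876543210, .branch 9, .embed 34 0xcba9876543210,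
    .embed 34 0xcab9876543210, .branch 10, .branch 10, .embed 32 0xdcba9876543210,
    .embed 32 0xcdba9876543210, .embed 31 0xdcba9876543210, .embed 31 0xcdba9876543210,
    .embed 74 0x18764, .branch 5, .embed 15 0x9876543210, .branch 5, .embed 27 0x9876543210,
    .embed 7 0xa9876543210, .branch 5, .embed 16 0xa9876543210, .embed 7 0xa9876543210, .branch 8,
    .embed 15 0x5821940763, .embed 2 0xba9876543210, .embed 2 0xab9876543210, .branch 8,
    .embed 15 0x5821940763, .embed 3 0xcba9876543210, .embed 3 0xcab9876543210, .branch 9,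
    .embed 1 0xdcba9876543210, .embed 1 0xdcab9876543210, .embed 0 0xdcba9876543210,
    .embed 0 0xcdba9876543210]),
  (12, 0xbaa9a89695878475736463524130212010,
   [.branch 11, .branch 11, .branch 12, .branch 12]),
  (13, 0xcabab8a99695878475736463524130212010,
   [.branch 11, .branch 12, .branch 13, .branch 12, .embed 76 0x9cdba]),
  (14, 0xdacbcab8a99695878475736463524130212010,
   [.branch 11, .embed 77 0x9dbca]),
  (12, 0xb8a99695878475736463524130212010,
   [.branch 10, .branch 10, .embed 1 0xcba9876543210, .branch 10, .embed 1 0xcba9876543210,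
    .branch 11, .embed 0 0xdcba9876543210, .embed 0 0xcdba9876543210]),
  (14, 0xdbcab8b7a9a896958475736463524130212010,
   [.branch 12, .branch 12])]

/-- Patterns with the steps that settle them, part 3. -/
def searchList3 : List (ℕ × ℕ × List Step) := [
  (12, 0xb8b7a9a896958475736463524130212010,
   [.branch 10, .grow, .branch 12, .branch 12, .branch 11, .embed 80 0x4bca8,
    .embed 0 0xdcba9876543210]),
  (14, 0xdbcbcac8b7a9a896958475736463524130212010,
   [.branch 13]),
  (13, 0xc8b7a9a896958475736463524130212010,
   [.branch 10, .branch 11, .embed 82 0x4cba8, .branch 12, .branch 12, .branch 12, .branch 11,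
    .embed 0 0xdcba9876543210, .branch 11, .branch 11, .branch 12, .branch 12, .embed 82 0x4cda8,
    .embed 82 0x4cda8]),
  (14, 0xdacbcac8b8b7a996958475736463524130212010,
   [.branch 13]),
  (13, 0xc8b8b7a996958475736463524130212010,
   [.branch 11, .branch 10, .embed 84 0x4cab8, .branch 12, .branch 12, .branch 12, .branch 10,
    .embed 0 0xdcba9876543210, .branch 10, .branch 10, .branch 12, .branch 12, .embed 84 0x4cdb8,
    .embed 84 0x4cdb8]),
  (14, 0xd8cbcac8bab7a996958475736463524130212010,
   [.branch 13]),
  (14, 0xd8cac8bab7a996958475736463524130212010,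
   [.branch 11, .embed 0 0xdcba9876543210, .branch 12, .embed 86 0x9cdba]),
  (14, 0xd8cac8b7a996958475736463524130212010,
   [.branch 10, .embed 0 0xdcba9876543210, .embed 87 0x4dac8]),
  (11, 0xa996958475736463524130212010,
   [.branch 7, .branch 8, .branch 10, .embed 12 0xba9876543210, .embed 9 0xba9876543210,
    .embed 88 0x29a75, .branch 8, .branch 8, .embed 7 0xba9876543210, .embed 5 0xcba9876543210,
    .branch 8, .embed 7 0xba9876543210, .embed 3 0xcba9876543210, .branch 8,
    .embed 5 0xcba9876543210, .embed 3 0xcba9876543210, .branch 10, .branch 10,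
    .embed 1 0xdcba9876543210, .embed 1 0xcdba9876543210, .embed 0 0xdcba9876543210,
    .embed 0 0xcdba9876543210]),
  (13, 0xc8b8b7a9a7a5969584736463524130212010,
   [.branch 11, .branch 12, .branch 13, .branch 12, .embed 89 0x4cdb8]),
  (14, 0xd8cbc8b7a9a7a5969584736463524130212010,
   [.branch 11, .embed 90 0x4dbc8]),
  (11, 0xa9a7a5969584736463524130212010,
   [.branch 7, .branch 8, .branch 11, .branch 11, .branch 12, .branch 12, .branch 8, .branch 8,
    .embed 1 0xcba9876543210, .branch 8, .embed 1 0xcba9876543210, .branch 11,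
    .embed 0 0xdcba9876543210, .embed 0 0xcdba9876543210]),
  (13, 0xc8bab7a9a596958784736463524130212010,
   [.branch 11, .embed 92 0x3bc87, .branch 12, .branch 12]),
  (12, 0xbab7a9a596958784736463524130212010,
   [.branch 8, .grow, .branch 12, .branch 12, .embed 0 0xcba9876543210]),
  (14, 0xdbcbc8c7baa9a596958784736463524130212010,
   [.branch 13]),
  (13, 0xc7baa9a596958784736463524130212010,
   [.branch 8, .embed 2 0xcba9786534201, .branch 12, .branch 11, .embed 0 0xdcba9876543210,
    .branch 11, .branch 11, .branch 12, .branch 12, .embed 95 0x3cd87, .embed 95 0x3cd87]),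
  (13, 0xc7bab7a9a5969584736463524130212010,
   [.branch 11, .branch 8, .embed 96 0x3c8b7, .branch 12, .branch 12, .branch 12, .branch 8,
    .branch 13, .branch 8, .branch 8, .branch 12, .branch 12, .embed 96 0x3cdb7, .embed 96 0x3cdb7]),
  (12, 0xbab7a9a5969584736463524130212010,
   [.branch 7, .embed 3 0xba9876543210, .embed 0 0xcba9876543210]),
  (14, 0xd7c8c7baa9a5969584736463524130212010,
   [.branch 8, .embed 1 0xcba9786534201, .embed 98 0x3d8c7]),
  (14, 0xdccbc8b7b5a9a8a7969584736463524130212010,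
   [.branch 13]),
  (14, 0xdbc8b7b5a9a8a7969584736463524130212010,
   [.branch 12, .branch 12]),
  (13, 0xc8b7b5a9a8a7969584736463524130212010,
   [.branch 11, .branch 12, .embed 1 0xdcba9876543210, .embed 0 0xdcba9876543210]),
  (14, 0xd8cbc7b5a9a8a7969584736463524130212010,
   [.branch 11, .branch 12, .embed 107 0xdcba9876543210]),
  (14, 0xd8c7b5a9a8a7969584736463524130212010,
   [.branch 11, .embed 0 0xdcba9876543210, .embed 0 0xcdba9786534201]),
  (14, 0xdbd8cbcab5a9a796958784736463524130212010,
   [.branch 12, .embed 110 0xdcba9876543210]),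
  (14, 0xdccac8b8b7b5a9a7969584736463524130212010,
   [.branch 13]),
  (14, 0xdbd8cac8b7b5a9a7969584736463524130212010,
   [.branch 12, .embed 113 0xdcba9876543210]),
  (14, 0xd8cbcac7b8b5a9a7969584736463524130212010,
   [.branch 13]),
  (13, 0xcbcac7b8b5a9a7969584736463524130212010,
   [.branch 8, .embed 0 0xdcba9876543210]),
  (14, 0xdbcbcac7b5a9a7969584736463524130212010,
   [.branch 8, .branch 8]),
  (14, 0xdcd8cac7b8b5a9a7969584736463524130212010,
   [.branch 11, .embed 118 0xdcba9876543210]),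
  (14, 0xd7cbcac8b5a9a7969584736463524130212010,
   [.branch 8, .branch 13, .branch 11, .embed 111 0x4dbc8]),
  (14, 0xd7cab5a9a7969584736463524130212010,
   [.branch 12, .branch 12, .embed 0 0xdcba9876543210, .embed 112 0x3dca7, .branch 12,
    .embed 0 0xdcba9876543210, .embed 112 0x3dca7, .embed 112 0x3dca7]),
  (13, 0xcab5a9a7969584736463524130212010,
   [.branch 7, .branch 8, .branch 11, .branch 12, .branch 13, .branch 12, .branch 12,
    .embed 113 0x3ac87, .branch 11, .branch 11, .embed 8 0xdcba9876543210, .branch 11,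
    .embed 8 0xdcba9876543210, .branch 11, .branch 8, .branch 12, .embed 7 0xdcba9876543210,
    .branch 12, .branch 12, .embed 113 0x3bca7, .branch 8, .branch 8, .embed 6 0xdcba9876543210,
    .branch 8, .embed 6 0xdcba9876543210, .branch 12, .branch 8, .branch 11, .branch 13,
    .branch 11, .branch 11, .branch 11, .embed 4 0xcba9876543210, .embed 3 0xdcba9876543210,
    .branch 8, .branch 8, .embed 2 0xdcba9876543210, .branch 8, .embed 2 0xdcba9876543210,
    .embed 0 0xdcba9876543210]),
  (12, 0xb5a9a7969584736463524130212010,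
   [.branch 10, .branch 7, .embed 95 0xb25106943a87, .branch 8, .embed 114 0x3b8a7,
    .embed 12 0xcba9876543210, .branch 8, .embed 12 0xcba9786534201, .embed 114 0x3c8a7,
    .embed 10 0xdcba9876543210, .embed 114 0x2ba95, .embed 0 0xcba9876543210]),
  (14, 0xdacac8b7b5a996958784736463524130212010,
   [.branch 11, .embed 115 0x3bc87, .branch 12, .embed 124 0xdcba9876543210]),
  (14, 0xdacab7b5a996958784736463524130212010,
   [.branch 8, .branch 12, .branch 12, .embed 0 0xdcba9876543210, .embed 0 0xcdba9876543210]),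
  (14, 0xdacac7b5a996958784736463524130212010,
   [.branch 8, .embed 1 0xdcba9786534201, .branch 11, .branch 11, .branch 12, .branch 11,
    .embed 117 0x9dbca, .embed 117 0x3cd87]),
  (14, 0xdacac7b7b5a9969584736463524130212010,
   [.branch 11, .branch 8, .embed 118 0x3c8b7, .branch 12, .embed 128 0xdcba9876543210, .branch 8,
    .branch 8, .branch 12, .branch 8, .embed 118 0x4dac8, .embed 118 0x3cdb7]),
  (14, 0xdacac7b5a9969584736463524130212010,
   [.branch 7, .embed 1 0xdcba9876543210, .embed 0 0xdcba9876543210, .embed 119 0x3dac7])]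

/-- Patterns with the steps that settle them, part 4. -/
def searchList4 : List (ℕ × ℕ × List Step) := [
  (14, 0xdacab5a9969584736463524130212010,
   [.branch 7, .branch 7, .embed 3 0xdcba9876543210, .embed 2 0xdcba9876543210,
    .embed 2 0xcdba9876543210, .branch 7, .embed 3 0xdcba9876543210, .embed 1 0xdcba9876543210,
    .embed 1 0xcdba9876543210, .embed 0 0xdcba9876543210, .embed 0 0xcdba9876543210]),
  (12, 0xb5a9969584736463524130212010,
   [.branch 10, .embed 6 0xba9876543210, .embed 6 0xba9786534201, .embed 121 0x2ba95, .branch 10,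
    .embed 7 0xcba9876543210, .embed 7 0xcba9786534201, .embed 121 0x2ba95,
    .embed 0 0xdcba9876543210]),
  (11, 0xa9969584736463524130212010,
   [.branch 5, .embed 33 0xa9876543210, .embed 33 0xa9786534201, .branch 10,
    .embed 30 0xa9876543210, .embed 30 0xa9786534201, .branch 7, .branch 7,
    .embed 28 0xba9876543210, .embed 26 0xcba9876543210, .embed 24 0xba9876543210, .branch 7,
    .embed 26 0xcba9876543210, .embed 25 0xcba9876543210, .branch 8, .embed 24 0xba9786534201,
    .embed 23 0xdcba9876543210, .embed 23 0xcdba9876543210, .embed 0 0xba9876543210]),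
  (10, 0x969584736463524130212010,
   [.branch 9, .embed 123 0x7963, .embed 123 0x18964, .embed 0 0xa9876543210]),
  (14, 0xdbcab9b8a9a796858475736463524130212010,
   [.branch 12, .branch 12]),
  (13, 0xcab9b8a9a796858475736463524130212010,
   [.branch 11, .embed 125 0x6bca9, .embed 0 0xdcba9876543210]),
  (14, 0xdac8b9a9a796858475736463524130212010,
   [.branch 11, .branch 11, .embed 126 0x6bda9, .embed 126 0x6bda9]),
  (13, 0xc8b9a9a796858475736463524130212010,
   [.branch 10, .branch 11, .branch 12, .branch 13, .branch 12, .branch 12,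
    .embed 1 0xbc9a867453120, .embed 0 0xdcba9876543210]),
  (12, 0xb9a9a796858475736463524130212010,
   [.branch 8, .embed 128 0x28a75, .branch 10, .grow, .branch 12, .branch 12,
    .embed 2 0xcba9876543210, .embed 0 0xcba9876543210]),
  (14, 0xd8cac7bab9a996858475736463524130212010,
   [.branch 12, .embed 129 0x6bca9, .embed 1 0x9adc687435102]),
  (14, 0xd8cac7b9a996858475736463524130212010,
   [.branch 12, .embed 130 0x6bca9, .embed 2 0x9adc687435102]),
  (14, 0xdccbc8b9b7a9a8a5968475736463524130212010,
   [.branch 13]),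
  (14, 0xdccac8b9b8b7a9a5968475736463524130212010,
   [.branch 13]),
  (14, 0xdbd8cac8b9b7a9a5968475736463524130212010,
   [.branch 12, .embed 139 0x201365794ab8cd]),
  (12, 0xb9b7a9a5968475736463524130212010,
   [.branch 10, .branch 8, .embed 134 0x4b9a8, .branch 11, .branch 12, .embed 2 0xdcba9876543210,
    .branch 12, .branch 12, .embed 134 0x2ab75, .branch 11, .branch 8, .branch 12,
    .embed 1 0xdcba9876543210, .branch 12, .branch 12, .embed 134 0x6bca9, .branch 8, .branch 8,
    .embed 0 0xdcba9876543210, .branch 8, .embed 0 0xdcba9876543210]),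
  (14, 0xdbcbc8c7b9a9a8a5968475736463524130212010,
   [.branch 13]),
  (14, 0xdcc8c7b9a9a8a5968475736463524130212010,
   [.branch 11, .branch 11]),
  (14, 0xdbd8cbc7b9a9a8a5968475736463524130212010,
   [.branch 12, .embed 146 0x132546a789cdb]),
  (14, 0xd8cbc7b9a9a8a5968475736463524130212010,
   [.branch 11, .embed 0 0xdcba9876543210]),
  (14, 0xdbd8c8c7bab9a9a5968475736463524130212010,
   [.branch 12, .embed 150 0xdcba9876543210]),
  (14, 0xdacbc7b9b8a9a5968475736463524130212010,
   [.branch 8, .embed 32 0xd2503a16794cb8, .branch 12, .embed 140 0x4dcb8]),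
  (12, 0xb9a9a5968475736463524130212010,
   [.branch 7, .embed 17 0x8a67453120, .embed 91 0xb896a7435102, .embed 6 0xba9876543210,
    .branch 10, .branch 8, .embed 141 0x4b9a8, .branch 12, .branch 11, .embed 5 0xdcba9876543210,
    .embed 4 0xdcba9876543210, .branch 11, .embed 2 0xdcba9876543210, .branch 11,
    .embed 3 0xdcba9876543210, .branch 11, .branch 8, .branch 12, .branch 13, .branch 12,
    .branch 12, .branch 12, .embed 32 0x14038276c59ba, .embed 31 0x81403d276c59ba, .branch 8,
    .branch 8, .embed 1 0xdcba9876543210, .branch 8, .embed 1 0xdcba9876543210, .embed 141 0x2ac75,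
    .branch 11, .branch 11, .embed 0 0xdcba9876543210, .embed 141 0x6bda9, .branch 11,
    .embed 0 0xdcba9876543210, .embed 141 0x6bda9, .embed 141 0x6bda9]),
  (13, 0xc5bab9b8a9a7968475736463524130212010,
   [.branch 8, .branch 12, .branch 13, .branch 12, .branch 12]),
  (14, 0xdbd8c8c5bab9a9a7968475736463524130212010,
   [.branch 12, .embed 155 0xdcba9876543210]),
  (14, 0xdacbc8c5b9b8a9a7968475736463524130212010,
   [.branch 13]),
  (14, 0xdacbc5b9b8a9a7968475736463524130212010,
   [.branch 8, .embed 0 0xdcba9876543210, .branch 12, .embed 145 0x4dcb8]),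
  (13, 0xc5b9a9a7968475736463524130212010,
   [.branch 10, .embed 11 0x98ac67453120, .branch 11, .embed 3 0xcba9876543210,
    .embed 3 0x8b9ac67453120, .branch 8, .branch 8, .embed 2 0xdcba9876543210, .branch 8,
    .embed 2 0xdcba9876543210, .embed 146 0x2ca75, .branch 11, .branch 11,
    .embed 0 0xdcba9876543210, .embed 146 0x6bda9, .branch 11, .embed 0 0xdcba9876543210,
    .embed 146 0x6bda9, .embed 146 0x6bda9]),
  (14, 0xd7cac8c5b9a9968475736463524130212010,
   [.branch 8, .branch 11, .branch 11, .branch 10, .embed 147 0x4cab8, .branch 11,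
    .embed 147 0x6bda9, .branch 13, .embed 147 0x4dac8, .embed 8 0xa9b8dc67453120]),
  (14, 0xd7cac5b9a9968475736463524130212010,
   [.branch 12, .embed 0 0xdcba9876543210, .embed 148 0x6bca9, .embed 148 0x2cd75]),
  (13, 0xc5b9a9968475736463524130212010,
   [.branch 7, .embed 25 0x8c67453120, .embed 2 0xcba9876543210, .embed 2 0xcab9876543210,
    .embed 74 0x6c7435102, .branch 12, .branch 12, .embed 1 0xdcba9876543210,
    .embed 1 0xdcab9876543210, .embed 149 0x2cd75, .embed 0 0xdcba9876543210,
    .embed 0 0xdcab9876543210, .embed 149 0x2cd75]),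
  (12, 0xb9a9968475736463524130212010,
   [.branch 5, .branch 7, .embed 114 0xba9687435102, .embed 21 0xba9876543210,
    .embed 21 0xab9876543210, .branch 8, .embed 22 0xcba9786534201, .embed 22 0xcab9786534201,
    .embed 150 0x28c75, .branch 10, .branch 10, .embed 20 0xdcba9876543210,
    .embed 20 0xcdba9786534201, .embed 19 0xdcba9876543210, .embed 19 0xcdba9786534201,
    .embed 8 0xba9876543210, .embed 8 0xab9876543210, .embed 0 0xcba9876543210]),
  (14, 0xdccbc5b9b8a9a7a5968784736463524130212010,
   [.branch 13]),
  (14, 0xdbd8cbc5b9a9a7a5968784736463524130212010,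
   [.branch 12, .embed 159 0x1043726a859dcb]),
  (14, 0xd7c8c5b9b8a9a7a59684736463524130212010,
   [.branch 11, .embed 8 0xd20731a6549c8b, .branch 12, .embed 153 0x4cdb8]),
  (14, 0xd8d7c5b9b8a9a7a59684736463524130212010,
   [.branch 11, .branch 12, .embed 154 0x4dcb8, .embed 72 0xc25031a6749d8b]),
  (14, 0xd8d7c8c5b9a9a7a59684736463524130212010,
   [.branch 12, .branch 11, .embed 155 0x4dbc8, .branch 11]),
  (13, 0xc5b9a9a7a59684736463524130212010,
   [.branch 7, .branch 8, .branch 11, .branch 12, .embed 4 0xdcba9876543210, .branch 12,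
    .branch 12, .branch 12, .branch 11, .branch 13, .branch 11, .branch 11, .branch 11, .branch 11,
    .embed 3 0xdcba9876543210, .branch 11, .embed 3 0xdcba9876543210, .embed 156 0x3b9a7,
    .embed 156 0x2c7a5, .branch 8, .branch 8, .embed 2 0xdcba9876543210, .embed 1 0xdcba9876543210,
    .branch 8, .embed 2 0xdcba9876543210, .embed 0 0xdcba9876543210, .branch 8,
    .embed 1 0xdcba9876543210, .embed 0 0xdcba9876543210]),
  (14, 0xd8d7c8c5bab9b7a9a59684736463524130212010,
   [.branch 12, .embed 170 0xdcba9876543210]),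
  (13, 0xc5bab9b7a9a59684736463524130212010,
   [.branch 7, .branch 8, .branch 12, .branch 13, .branch 12, .branch 12, .embed 16 0x1204c3567a9b,
    .branch 8, .branch 8, .embed 0 0xdcba9876543210, .branch 8, .embed 0 0xdcba9876543210]),
  (14, 0xdbd8c7c5bab9a9a5968784736463524130212010,
   [.branch 12, .embed 159 0x3cd87])]

/-- Patterns with the steps that settle them, part 5. -/
def searchList5 : List (ℕ × ℕ × List Step) := [
  (14, 0xdbc7c5bab9a9a5968784736463524130212010,
   [.branch 8, .branch 13, .embed 0 0xdcba9876543210]),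
  (14, 0xdbd7c5bab9a9a5968784736463524130212010,
   [.branch 8, .embed 1 0xdcba9786534201, .embed 66 0xc25a9106b43d87]),
  (14, 0xdbd7c7c5bab9a9a59684736463524130212010,
   [.branch 12, .branch 8, .embed 162 0x3d8c7, .embed 99 0x8140629a35b7cd]),
  (14, 0xd8cac7c5b9b8b7a9a59684736463524130212010,
   [.branch 13]),
  (14, 0xd8d7cac7c5b9b8a9a59684736463524130212010,
   [.branch 11, .embed 172 0x52c03a16794db8]),
  (13, 0xcac7c5b9a9a59684736463524130212010,
   [.branch 7, .branch 8, .branch 11, .branch 13, .branch 11, .branch 11, .branch 11, .branch 8,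
    .embed 1 0xdcba9876543210, .branch 8, .branch 8, .branch 8, .branch 8,
    .embed 0 0xdcba9876543210, .branch 8, .embed 0 0xdcba9876543210]),
  (14, 0xdcd8cac5b9b7a9a5968784736463524130212010,
   [.branch 11, .embed 166 0x3bd87]),
  (14, 0xdccac5b9b7a9a5968784736463524130212010,
   [.branch 8, .embed 147 0xdc52a106943b87, .embed 0 0xdcba9876543210]),
  (14, 0xdcd7cac5b9a9a5968784736463524130212010,
   [.branch 8, .embed 1 0xdcba9786534201, .branch 11]),
  (14, 0xdcd7cac5b9b7a9a59684736463524130212010,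
   [.branch 11, .branch 8, .embed 169 0x3d8b7, .embed 116 0x8140265a39c7bd]),
  (14, 0xdcd7cac5b9a9a59684736463524130212010,
   [.branch 7, .embed 1 0xdcba9876543210, .embed 0 0xdcba9876543210]),
  (14, 0xdad8d7c8c5b9b7a9a59684736463524130212010,
   [.branch 11, .embed 185 0xdcba9876543210]),
  (14, 0xdad7c5b9a9a59684736463524130212010,
   [.branch 13, .branch 7, .embed 50 0x5b9106a43d87, .branch 8, .embed 172 0x3d8b7,
    .embed 0 0xdcba9876543210, .branch 8, .embed 0 0xdcba9786534201, .embed 172 0x3d8c7,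
    .embed 172 0x6bda9, .embed 172 0x2cda5]),
  (13, 0xc5b9a9a59684736463524130212010,
   [.branch 10, .embed 16 0xcba9876543210, .embed 16 0xcba9786534201, .branch 11,
    .embed 14 0xcba9876543210, .embed 14 0xcba9786534201, .embed 173 0x2cba5, .branch 7, .branch 7,
    .embed 12 0xdcba9876543210, .embed 11 0xdcba9876543210, .branch 7, .embed 12 0xdcba9876543210,
    .embed 10 0xdcba9876543210, .branch 7, .embed 11 0xdcba9876543210, .embed 10 0xdcba9876543210,
    .branch 12, .embed 7 0xcba9876543210, .embed 7 0xcba9786534201, .embed 173 0x6bca9, .branch 7,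
    .branch 7, .embed 5 0xdcba9876543210, .embed 4 0xdcba9876543210, .branch 7,
    .embed 5 0xdcba9876543210, .embed 3 0xdcba9876543210, .embed 2 0xdcba9876543210, .branch 13,
    .embed 0 0xdcba9876543210, .embed 0 0xdcba9786534201, .embed 173 0x6bda9, .embed 173 0x2cda5]),
  (12, 0xb9a9a59684736463524130212010,
   [.branch 5, .embed 32 0xba9876543210, .embed 32 0xba9786534201, .embed 174 0x2b9a5,
    .embed 0 0xcba9876543210]),
  (14, 0xd5cac5b9b8a9a7968784736463524130212010,
   [.branch 11, .embed 175 0x6bca9, .branch 12, .embed 190 0xdcba9876543210]),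
  (14, 0xd5c8c5b9a9a7968784736463524130212010,
   [.branch 10, .branch 11, .embed 90 0xd20145386c79ba, .branch 12, .embed 192 0xdcba9876543210,
    .embed 176 0x3ac87, .branch 13, .embed 176 0x6bda9, .embed 12 0xb16039472a85dc]),
  (14, 0xd5c5b9a9a7968784736463524130212010,
   [.branch 8, .embed 154 0x52b106943a87, .branch 10, .embed 177 0x3ab87,
    .embed 1 0xdcba9876543210, .embed 1 0xcdba9876543210, .embed 0 0xdcba9876543210,
    .embed 0 0xcdba9876543210]),
  (14, 0xdad5c8c7c5bab9a9968784736463524130212010,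
   [.branch 11, .embed 178 0x6bda9]),
  (14, 0xd8d5cac7c5b9a9968784736463524130212010,
   [.branch 10, .branch 11, .embed 196 0xdcba9876543210, .embed 179 0x2dac5]),
  (14, 0xd5c7c5b9a9968784736463524130212010,
   [.branch 8, .embed 3 0xdcba9786534201, .embed 3 0xdcab9786534201, .branch 10, .branch 10,
    .embed 1 0xdcba9876543210, .branch 10, .embed 1 0xdcba9876543210, .branch 12,
    .embed 0 0xdcba9876543210, .embed 0 0xdcab9876543210, .embed 180 0x3cd87]),
  (14, 0xd8d5cac7c5b9b8a9a79684736463524130212010,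
   [.branch 11, .embed 199 0xdcba9876543210]),
  (14, 0xd5c7c5b9a9a79684736463524130212010,
   [.branch 10, .branch 8, .embed 182 0x4b9a8, .embed 182 0x3c8a7, .branch 12, .branch 11,
    .embed 182 0x2dbc5, .branch 11, .branch 11, .embed 31 0x210c43876ba9, .embed 182 0x3cba7,
    .branch 12, .branch 8, .embed 182 0x2d8c5, .embed 127 0x8104235c67d9ab, .branch 8, .branch 8,
    .embed 0 0xdcba9876543210, .branch 8, .embed 0 0xdcba9876543210, .branch 13, .branch 8,
    .branch 11, .embed 201 0xdcba9876543210, .embed 182 0x2d8c5, .embed 182 0x6bda9,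
    .embed 182 0x3cda7]),
  (14, 0xd5c5b9a9a79684736463524130212010,
   [.branch 7, .embed 5 0xdcba9876543210, .embed 183 0x3b9a7, .embed 0 0xdcba9876543210,
    .embed 0 0xcdba9876543210]),
  (14, 0xd5c7c5b9a99684736463524130212010,
   [.branch 7, .embed 3 0xdcba9876543210, .embed 1 0xdcba9876543210, .embed 1 0xdcab9876543210,
    .embed 184 0x2d7c5]),
  (10, 0x9684736463524130212010,
   [.branch 9, .embed 61 0x9876543210, .embed 185 0x7963, .embed 185 0x18964, .branch 9,
    .embed 62 0xa9876543210, .embed 185 0x7963, .embed 185 0x18964, .branch 5,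
    .embed 34 0xba9876543210, .embed 34 0xba9786534201, .embed 10 0xba9876543210,
    .embed 10 0xab9876543210, .branch 5, .embed 35 0xcba9876543210, .embed 35 0xcba9786534201,
    .embed 11 0xcba9876543210, .embed 11 0xcab9876543210, .branch 7, .branch 7,
    .embed 7 0xdcba9876543210, .embed 7 0xdcab9876543210, .embed 4 0xdcba9876543210,
    .embed 4 0xcdba9876543210, .embed 1 0xdcba9876543210, .embed 1 0xdcab9876543210,
    .embed 0 0xdcba9876543210, .embed 0 0xcdba9876543210]),
  (9, 0x84736463524130212010,
   [.branch 6, .branch 5, .embed 186 0x7563, .embed 186 0x18564, .embed 152 0x9876543210,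
    .embed 111 0x876543210, .embed 111 0x786534201, .embed 0 0x9876543210]),
  (8, 0x736463524130212010,
   [.branch 4, .embed 187 0x4521, .embed 187 0x7463, .embed 0 0x876543210]),
  (13, 0xcab9b5a7a598948684767363524130212010,
   [.branch 11, .embed 188 0x2bca5, .branch 12, .branch 12]),
  (13, 0xc9b5a7a598948684767363524130212010,
   [.branch 10, .branch 11, .branch 12, .branch 13, .branch 12, .branch 12,
    .embed 0 0xbc59421a80763, .branch 11, .branch 11, .embed 189 0x2bda5, .embed 189 0x2bda5]),
  (12, 0xb5a7a598948684767363524130212010,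
   [.branch 9, .embed 130 0xb215490a8376, .branch 10, .grow, .branch 12, .branch 12,
    .embed 1 0xcba9876543210, .embed 0 0xcba9876543210]),
  (14, 0xdad9cbc9b8b5a7a5948684767363524130212010,
   [.branch 12, .embed 202 0x2376158a4bd9c]),
  (12, 0xb8b5a7a5948684767363524130212010,
   [.branch 11, .embed 192 0x19b84, .embed 132 0x91245b08a367, .branch 10, .branch 9, .branch 12,
    .branch 13, .branch 12, .branch 12, .embed 192 0x2bca5, .branch 9, .branch 9,
    .embed 0 0xdcba9876543210, .branch 9, .embed 0 0xdcba9876543210]),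
  (14, 0xdad9c8b9b5a7a5948684767363524130212010,
   [.branch 11, .branch 12, .embed 193 0x4dcb9, .embed 193 0x2bda5]),
  (12, 0xb5a7a5948684767363524130212010,
   [.branch 8, .embed 3 0xba9876543210, .embed 194 0x38a76, .embed 1 0xba9876543210, .branch 10,
    .embed 1 0x98ba67453120, .embed 3 0x98ba67453120, .embed 7 0x54c0a8376, .branch 9, .branch 9,
    .embed 194 0x19c84, .embed 0 0xdcba9876543210, .embed 194 0x19c84, .branch 9,
    .embed 0 0xdcba9876543210, .embed 194 0x19c84]),
  (14, 0xd9cac7bab5a598948684767363524130212010,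
   [.branch 12, .embed 195 0x2bca5, .embed 5 0x5ad2194c08736]),
  (14, 0xd9cac7b5a598948684767363524130212010,
   [.branch 12, .embed 196 0x2bca5, .embed 6 0x5ad2194c08736]),
  (14, 0xd9cbc9c7bab5a8a5948684767363524130212010,
   [.branch 13]),
  (14, 0xdbc9c7bab5a8a5948684767363524130212010,
   [.branch 9, .branch 12, .embed 218 0xdcba9876543210]),
  (14, 0xdacbc7b9b5a8a5948684767363524130212010,
   [.branch 9, .embed 1 0xd5b9a421c80763, .branch 12, .embed 199 0x4dcb9])]

/-- Patterns with the steps that settle them, part 6. -/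
def searchList6 : List (ℕ × ℕ × List Step) := [
  (13, 0xc7b5a8a5948684767363524130212010,
   [.branch 10, .embed 200 0x19a84, .branch 11, .embed 12 0x642985ba, .branch 12, .branch 9,
    .embed 2 0xdcba9876543210, .branch 9, .branch 9, .branch 9, .embed 1 0xdcba9876543210,
    .embed 1 0xcd7698ba345012, .embed 12 0x4a0c8376, .branch 11, .branch 11,
    .embed 0 0xdcba9876543210, .embed 200 0x2bda5, .branch 11, .embed 0 0xdcba9876543210,
    .embed 200 0x2bda5, .embed 200 0x2bda5]),
  (14, 0xdad8c7b5a5948684767363524130212010,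
   [.branch 13, .embed 201 0x19d84, .embed 201 0x2bda5, .embed 13 0x4d0c8376]),
  (13, 0xc7b5a5948684767363524130212010,
   [.branch 8, .branch 9, .embed 12 0xcba7698534201, .embed 12 0xcab7698534201,
    .embed 14 0x490c8376, .branch 10, .branch 10, .embed 6 0xdcba9876543210,
    .embed 6 0xcdba7698534201, .embed 5 0xdcba9876543210, .embed 5 0xcdba7698534201,
    .embed 1 0xcba9876543210, .embed 1 0xcab9876543210, .embed 202 0x38c76, .branch 13,
    .embed 202 0x19d84, .embed 0 0xdcba9876543210, .embed 0 0xdcab9876543210, .embed 14 0x4d0c8376]),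
  (12, 0xb5a5948684767363524130212010,
   [.branch 7, .embed 203 0x7863, .branch 8, .embed 203 0x38976, .embed 15 0xa4098376,
    .embed 15 0xb4098376, .embed 15 0xc4098376, .embed 8 0xba9876543210, .embed 8 0xab9876543210,
    .embed 0 0xcba9876543210]),
  (14, 0xdbd9d7cac8c6b5a5989484767363524130212010,
   [.branch 10, .embed 225 0xdcba9876543210]),
  (14, 0xd9d7cac8c6b5a59484767363524130212010,
   [.branch 13, .embed 205 0x19d84, .embed 34 0x41b2598a0dc376, .branch 8,
    .embed 0 0xdcba9876543210, .embed 0 0x54b9a821dc0763, .branch 9, .embed 227 0xdcba9876543210]),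
  (14, 0xd7cac8c6b5a59484767363524130212010,
   [.branch 13, .embed 18 0xa80dc376, .embed 0 0xdcba9876543210, .embed 18 0x8a0dc376,
    .embed 0 0xdc98ba76453120]),
  (14, 0xd7c8c6b5a59484767363524130212010,
   [.branch 12, .embed 207 0x19c84, .embed 0 0xdcba9876543210, .embed 0 0xdcab9876543210,
    .embed 207 0x3cd76]),
  (13, 0xc6b5a59484767363524130212010,
   [.branch 7, .embed 5 0xcba9867543210, .embed 5 0xcba8967543210, .embed 5 0xc98ba67453120,
    .embed 5 0xc98ab67453120, .embed 208 0x7c63, .branch 12, .embed 0 0xdcba9876543210,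
    .embed 0 0xdcba8976543210, .embed 0 0xdc98ba76453120, .embed 0 0xdc98ab76453120,
    .embed 208 0x3cd76]),
  (14, 0xdbc9b7b5a8a6a5979486847363524130212010,
   [.branch 12, .branch 12]),
  (13, 0xc9b7b5a8a6a5979486847363524130212010,
   [.branch 11, .embed 210 0x3bc97, .embed 0 0xdcba9876543210]),
  (13, 0xc7b5a8a6a5979486847363524130212010,
   [.branch 9, .embed 0 0xcba7698534201, .branch 12, .branch 11, .branch 13, .branch 11,
    .branch 11, .branch 12, .branch 12, .embed 211 0x3cd97, .embed 211 0x3cd97]),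
  (12, 0xb5a8a6a5979486847363524130212010,
   [.branch 7, .branch 9, .grow, .branch 12, .branch 12, .embed 1 0xcba9876543210,
    .embed 0 0xcba9876543210]),
  (14, 0xd7c9c7b5a8a6a59486847363524130212010,
   [.branch 9, .embed 1 0xc76ba98354021, .embed 213 0x3d9c7]),
  (12, 0xb8b7b5a9a6a5979486847363524130212010,
   [.grow, .branch 12, .branch 12]),
  (14, 0xdccbc7b8b5a9a6a5979486847363524130212010,
   [.branch 13]),
  (14, 0xdbc7b8b5a9a6a5979486847363524130212010,
   [.branch 12, .branch 12]),
  (13, 0xc7b8b5a9a6a5979486847363524130212010,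
   [.branch 11, .branch 12, .embed 1 0xdcba9876543210, .embed 0 0xdcba9876543210]),
  (14, 0xd7cbc9c7b8b5a9a6a59486847363524130212010,
   [.branch 13]),
  (14, 0xdbc9c7b8b5a9a6a59486847363524130212010,
   [.branch 7, .branch 12, .embed 242 0xdcba9876543210]),
  (13, 0xc9b8b5a9a6a59486847363524130212010,
   [.branch 11, .embed 2 0xc76ab98354021, .branch 12, .branch 7, .embed 1 0xdcba9876543210,
    .branch 7, .branch 7, .branch 7, .embed 0 0xdcba9876543210, .embed 0 0xcd98ba76453120]),
  (14, 0xdbcac7b8b5a6a5979486847363524130212010,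
   [.branch 9, .embed 108 0x2d1b805643a97c, .branch 12, .embed 221 0x3cd97]),
  (14, 0xdbd7cab8b5a6a5979486847363524130212010,
   [.branch 9, .branch 12, .embed 222 0x3dc97, .embed 109 0x2c0a615834b79d]),
  (14, 0xdbd7cac7b8b5a6a59486847363524130212010,
   [.branch 12, .branch 9, .embed 223 0x3d9c7, .embed 139 0x91248056b3ad7c]),
  (13, 0xcab8b5a6a59486847363524130212010,
   [.branch 11, .embed 3 0xc76ab98354021, .embed 224 0x19b84, .embed 224 0x2bca5, .branch 7,
    .branch 7, .embed 2 0xdcba9876543210, .embed 1 0xdcba9876543210, .branch 7,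
    .embed 2 0xdcba9876543210, .embed 0 0xdcba9876543210, .branch 7, .embed 1 0xdcba9876543210,
    .embed 0 0xdcba9876543210]),
  (14, 0xdacbc8b9b5a6a5979486847363524130212010,
   [.branch 7, .embed 225 0x3cb97, .branch 12, .embed 249 0xdcba9876543210]),
  (14, 0xdac8b9b5a6a5979486847363524130212010,
   [.branch 11, .embed 16 0xdcab8967543210, .embed 0 0xdcba9876543210, .embed 226 0x2bda5]),
  (14, 0xdad9c8b5a6a5979486847363524130212010,
   [.branch 13, .embed 105 0x1c85064a39d7, .embed 227 0x2bda5, .branch 7, .branch 11,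
    .embed 252 0xdcba9876543210, .embed 227 0x3cd97]),
  (14, 0xdad9c8b9b5a6a59486847363524130212010,
   [.branch 11, .embed 2 0xcd98ba76453120, .branch 12, .branch 7, .embed 254 0xdcba9876543210,
    .embed 228 0x4dcb9, .embed 228 0x2bda5]),
  (13, 0xc8b5a6a59486847363524130212010,
   [.branch 10, .embed 229 0x7a63, .embed 4 0xc98ba76453120, .embed 25 0x9876ba435102,
    .embed 229 0x3ac86, .branch 9, .branch 9, .embed 2 0xdcba9876543210, .embed 229 0x19c84,
    .embed 1 0xdcba9876543210, .branch 9, .embed 2 0xdcba9876543210, .embed 229 0x19c84,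
    .embed 0 0xdcba9876543210, .embed 229 0x19c84, .branch 9, .embed 1 0xdcba9876543210,
    .embed 0 0xdcba9876543210, .embed 229 0x19c84]),
  (12, 0xb5a6a59486847363524130212010,
   [.branch 8, .embed 230 0x7863, .embed 26 0xba7698534201, .branch 7, .embed 17 0xba9876543210,
    .embed 17 0x98ba76453120, .branch 7, .embed 18 0xcba9876543210, .embed 18 0xc98ba76453120,
    .branch 9, .embed 17 0x76ba98354021, .embed 16 0xdcba9876543210, .embed 16 0xcdba9876543210,
    .branch 10, .embed 230 0x7a63, .branch 9, .branch 7, .embed 15 0xba9876543210,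
    .embed 12 0xcba9876543210, .embed 230 0x19b84, .embed 9 0xcba9876543210, .embed 230 0x3ab86,
    .embed 5 0xcba9876543210, .embed 0 0xcba9876543210]),
  (14, 0xdacac8c6b7b5a59486847363524130212010,
   [.branch 11, .embed 0 0x8967ab435102, .embed 231 0x2bda5]),
  (13, 0xcac8c6b5a59486847363524130212010,
   [.branch 10, .embed 45 0x5074a38c6, .embed 45 0x5193a46c8, .embed 23 0xc9876ba435102,
    .branch 11, .embed 0 0xdcba9876543210, .embed 0 0xdcba7698534201, .embed 232 0x2bda5]),
  (14, 0xdcdac8c6b5a59486847363524130212010,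
   [.branch 13, .embed 46 0xa074d38c6, .embed 46 0xa193d46c8, .embed 233 0x2bda5]),
  (14, 0xd8cac9c6b5a59486847363524130212010,
   [.branch 9, .branch 7, .embed 234 0x3ac97, .embed 4 0xcab8967543210, .branch 10,
    .embed 25 0xc9876ba435102, .branch 11, .embed 48 0xd318564ac9, .branch 11,
    .embed 4 0xc6789ab345012, .embed 234 0x4cab9, .branch 10, .branch 7,
    .embed 261 0xdcba9876543210, .embed 234 0x2bda5, .embed 234 0x19d84]),
  (14, 0xd8cac6b5a59486847363524130212010,
   [.branch 12, .embed 235 0x7c63, .embed 0 0xdcba9876543210, .embed 235 0x2bca5,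
    .embed 235 0x3cd86]),
  (13, 0xc6b5a59486847363524130212010,
   [.branch 8, .embed 236 0x7863, .embed 32 0xba7698534201, .embed 6 0xcba7698534201,
    .embed 6 0xcab7698534201, .branch 12, .embed 236 0x7c63, .embed 236 0x19c84,
    .embed 3 0xcba9876543210, .embed 3 0xcab9876543210, .branch 13, .embed 48 0x74d38c6,
    .embed 48 0x193d46c8, .embed 2 0xdcba9876543210, .embed 2 0xdcab9876543210, .branch 12,
    .embed 236 0x7c63, .branch 12, .embed 236 0x7c63, .embed 1 0xdcba9876543210,
    .embed 1 0xdcab9876543210, .embed 236 0x3cd86, .embed 0 0xdcba9876543210,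
    .embed 0 0xdcab9876543210, .embed 236 0x3cd86]),
  (12, 0xb5a59486847363524130212010,
   [.branch 6, .embed 33 0xba9876543210, .embed 237 0x19684, .embed 6 0xba9876543210,
    .embed 6 0xab9876543210, .embed 0 0xcba9876543210]),
  (5, 0x4130212010,
   [.branch 2, .embed 238 0x42301, .embed 238 0x32410, .branch 3, .embed 238 0x23410,
    .embed 238 0x13520, .branch 3, .embed 238 0x23410, .embed 238 0x13520, .branch 4,
    .embed 238 0x4521, .embed 50 0x76543210, .embed 50 0x67543210, .branch 4, .embed 238 0x4521,
    .embed 51 0x876543210, .embed 51 0x867543210, .branch 5, .embed 50 0x76453120,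
    .embed 50 0x67453120, .embed 50 0x98354021, .embed 50 0x89354021, .branch 5,
    .embed 51 0xa76453120, .embed 51 0xa67453120, .embed 51 0xa98354021, .embed 51 0xa89354021,
    .branch 6, .branch 6, .embed 34 0xba9876543210, .embed 34 0xba8976543210,
    .embed 34 0x98ba76453120, .embed 34 0x98ab76453120, .embed 29 0xcba9876543210,
    .embed 0 0xba9876543210, .embed 0 0xba8976543210, .embed 0 0x98ba76453120,
    .embed 0 0x98ab76453120, .branch 6, .embed 29 0xcba9876543210, .embed 1 0xcba9876543210,
    .embed 1 0xcba8976543210, .embed 1 0xc98ba76453120, .embed 1 0xc98ab76453120, .branch 7,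
    .embed 0 0xba9867543210, .embed 0 0xba8967543210, .embed 0 0x98ba67453120,
    .embed 0 0x98ab67453120, .embed 238 0x7c63, .embed 238 0x7d63]),
  -- A triangle with a pendant edge. Every triangle in a cubic graph extends to it, so only
  -- triangle-free patterns are open after this entry.
  (4, 0x30212010,
   [.branch 1, .embed 226 0x3210, .embed 0 0x43210])]

/-- Patterns with the steps that settle them, part 7. -/
def searchList7 : List (ℕ × ℕ × List Step) := [
  (13, 0xcabab9a59693878483757264625141302010,
   [.branch 11, .embed 1 0x95cba, .branch 12, .embed 240 0x5cdba]),
  (11, 0xa59693878483757264625141302010,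
   [.branch 9, .branch 10, .branch 11, .branch 11, .branch 12, .embed 1 0xadcb, .branch 10,
    .branch 10, .embed 0 0xcba9876543210, .branch 10, .embed 0 0xcba9876543210, .branch 12,
    .branch 11, .embed 241 0x5dbca, .embed 1 0x5dca]),
  (13, 0xcab9b5a7a596938784837264625141302010,
   [.branch 11, .embed 242 0x1bca5, .branch 12, .branch 12]),
  (13, 0xc5b9a7a596938784837264625141302010,
   [.branch 10, .embed 0 0xcb59413a86072, .embed 4 0x71ca5, .branch 12, .branch 12,
    .embed 243 0x1cda5, .embed 243 0x1cda5]),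
  (12, 0xb9a7a596938784837264625141302010,
   [.branch 5, .branch 10, .embed 29 0x638240971ba5, .embed 1 0xcba9876543210,
    .embed 0 0xcba9876543210]),
  (14, 0xd5cac5b9a796938784837264625141302010,
   [.branch 10, .embed 1 0xc5b1394a80672, .embed 245 0x1dac5]),
  (11, 0xa796938784837264625141302010,
   [.branch 9, .embed 4 0xa5489761320, .embed 4 0x5a849137602, .branch 5, .embed 1 0xba9876543210,
    .embed 1 0xab7698542310, .branch 5, .embed 2 0xcba9876543210, .embed 2 0xcab7698542310,
    .branch 10, .embed 1 0x5b1394a80672, .embed 0 0xdcba9876543210, .embed 0 0xcdba9876543210]),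
  (13, 0xcab9b7a8a596938483757264625141302010,
   [.branch 11, .branch 12, .branch 13, .branch 12, .branch 12]),
  (14, 0xdacbc7b9a8a596938483757264625141302010,
   [.branch 11, .branch 12, .embed 267 0x364018259a7bdc]),
  (13, 0xc7b9a8a596938483757264625141302010,
   [.branch 10, .embed 1 0xcb792a3506814, .embed 249 0x1ac75, .branch 11,
    .embed 0 0xdcba9876543210, .embed 0 0xcdb792a3506814]),
  (14, 0xdbdacac7b9b5a896938483757264625141302010,
   [.branch 12, .embed 264 0x630419258b7adc]),
  (13, 0xc7b9b5a896938483757264625141302010,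
   [.branch 11, .branch 10, .branch 12, .branch 13, .branch 12, .branch 12, .embed 251 0x1bc75,
    .branch 10, .branch 10, .embed 0 0xdcba9876543210, .branch 10, .embed 0 0xdcba9876543210]),
  (12, 0xb9b5a896938483757264625141302010,
   [.branch 7, .branch 10, .embed 252 0x1ba75, .branch 11, .branch 12, .branch 13, .branch 12,
    .branch 12, .embed 176 0xa83460912b57, .embed 0 0xcba9876543210]),
  (14, 0xd7cbcac5b9a896938483757264625141302010,
   [.branch 10, .embed 101 0xd7210643598cba, .branch 11, .embed 253 0x8dbca]),
  (13, 0xc5b9a896938483757264625141302010,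
   [.branch 7, .embed 2 0xcab8954763120, .embed 4 0xcab8954763120, .embed 15 0x21c75, .branch 12,
    .branch 12, .embed 0 0xdcba9876543210, .embed 254 0x1cd75, .branch 12,
    .embed 0 0xdcba9876543210, .embed 254 0x1cd75, .embed 254 0x1cd75]),
  (12, 0xb9a896938483757264625141302010,
   [.branch 5, .branch 7, .embed 179 0xb93640821a75, .branch 10, .embed 255 0x1ab75,
    .embed 7 0xcba9876543210, .embed 5 0xcba9876543210, .embed 2 0xba9876543210,
    .embed 0 0xcba9876543210]),
  (14, 0xdbc7c5b9b5a8969384837264625141302010,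
   [.branch 12, .branch 7, .embed 37 0xd93460b1825a7c, .branch 10, .embed 256 0x2dac7,
    .embed 256 0x1cdb5]),
  (13, 0xc5b9b5a8969384837264625141302010,
   [.branch 11, .embed 4 0x5a1870b34296, .embed 4 0x5712a4b60893, .embed 18 0x91cb5, .branch 12,
    .embed 0 0xdcba9876543210, .embed 0 0xdcb792a3506814, .embed 257 0x1cdb5]),
  (12, 0xb9b5a8969384837264625141302010,
   [.branch 5, .embed 5 0xba9876543210, .embed 5 0xb792a3506814, .embed 0 0xcba9876543210]),
  (14, 0xd5c7c5b9a8969384837264625141302010,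
   [.branch 7, .embed 1 0xcab8954763120, .embed 4 0xca581b3704926, .embed 259 0x1d7c5]),
  (11, 0xa8969384837264625141302010,
   [.branch 9, .embed 13 0xa5489761320, .embed 260 0x7962, .embed 260 0x9a83, .branch 5,
    .embed 4 0xba9876543210, .embed 4 0xb792a3506814, .embed 1 0xba9876543210, .branch 5,
    .embed 5 0xcba9876543210, .embed 5 0xcb792a3506814, .embed 2 0xcba9876543210, .branch 7,
    .embed 1 0xab8954763120, .embed 4 0xa581b3704926, .embed 0 0xdcba9876543210,
    .embed 0 0xcdba9876543210]),
  (10, 0x969384837264625141302010,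
   [.branch 8, .embed 261 0x5841, .branch 7, .branch 5, .grow, .branch 10, .branch 10, .branch 10,
    .branch 11, .embed 21 0xdcba, .embed 21 0xcdba, .embed 19 0xa9876543210, .embed 261 0x7962,
    .embed 14 0xa9876543210, .embed 261 0x18964, .embed 0 0xa9876543210]),
  (14, 0xdccbcab8b7a9a695938483757264625141302010,
   [.branch 13]),
  (13, 0xc9bab8b7a695938483757264625141302010,
   [.branch 10, .branch 12, .branch 13, .branch 12, .branch 12]),
  (14, 0xdbdacac9b8b7a695938483757264625141302010,
   [.branch 12, .embed 289 0x1035428796bcad]),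
  (13, 0xc9b8b7a695938483757264625141302010,
   [.branch 11, .embed 1 0xcba9876543210, .embed 1 0xabc6789452310, .branch 10, .branch 10,
    .embed 0 0xdcba9876543210, .branch 10, .embed 0 0xdcba9876543210]),
  (14, 0xdad9c7bab8a695938483757264625141302010,
   [.branch 11, .branch 12, .embed 266 0x6dcba, .embed 133 0xc7051234968dab]),
  (14, 0xd9c7bab8a695938483757264625141302010,
   [.branch 10, .branch 11, .embed 134 0xd9051324786cba, .branch 12, .embed 267 0x6cdba,
    .embed 0 0xdcba9876543210]),
  (13, 0xcab8b5a9a697938483757264625141302010,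
   [.branch 11, .branch 12, .branch 13, .branch 12, .branch 12]),
  (14, 0xdacbcac9b8b5a697938483757264625141302010,
   [.branch 13]),
  (14, 0xdbcac9b8b5a697938483757264625141302010,
   [.branch 10, .branch 12, .embed 294 0x14285376b9adc]),
  (13, 0xc9b8b5a697938483757264625141302010,
   [.branch 11, .embed 2 0xca97b23685041, .branch 12, .branch 10, .embed 1 0xdcba9876543210,
    .branch 10, .branch 10, .branch 10, .embed 0 0xdcba9876543210, .embed 0 0xcd9ab786325401]),
  (14, 0xdbc9c7b8b5a9a6938483757264625141302010,
   [.branch 10, .embed 172 0xdb8105423769ca, .branch 12, .embed 272 0x3cda9]),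
  (14, 0xdbd9c7b8b5a9a6938483757264625141302010,
   [.branch 10, .branch 12, .embed 273 0x3dca9, .embed 173 0xc72145086b3ad9]),
  (14, 0xdbd9c9c7b8b5a6938483757264625141302010,
   [.branch 12, .branch 10, .embed 274 0x3dac9, .embed 142 0xa640128537b9cd]),
  (13, 0xc7b8b5a6938483757264625141302010,
   [.branch 11, .embed 275 0x9b83, .embed 3 0xca97b23685041, .embed 275 0x1bc75, .branch 9,
    .branch 9, .embed 2 0xdcba9876543210, .embed 1 0xdcba9876543210, .branch 9,
    .embed 2 0xdcba9876543210, .embed 0 0xdcba9876543210, .branch 9, .embed 1 0xdcba9876543210,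
    .embed 0 0xdcba9876543210]),
  (13, 0xc5bab8b7a9a6938483757264625141302010,
   [.branch 9, .branch 12, .branch 13, .branch 12, .branch 12]),
  (14, 0xdad9c9c5bab8b7a6938483757264625141302010,
   [.branch 12, .embed 303 0x2417086b53ac9d]),
  (14, 0xdbc9c5b8b7a9a6938483757264625141302010,
   [.branch 10, .embed 62 0xdb714280563ca9, .branch 12, .embed 278 0x3cda9]),
  (14, 0xdbd9c5b8b7a9a6938483757264625141302010,
   [.branch 10, .branch 12, .embed 279 0x3dca9, .embed 173 0xc52147086b3ad9])]

/-- Patterns with the steps that settle them, part 8. -/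
def searchList8 : List (ℕ × ℕ × List Step) := [
  (14, 0xdbd9c9c5b8b7a6938483757264625141302010,
   [.branch 12, .embed 1 0xd9bac786325401, .embed 144 0xa261407853bc9d]),
  (14, 0xd7cbc9c5b8a9a6938483757264625141302010,
   [.branch 10, .embed 281 0x3cba9, .branch 11, .embed 309 0xdcba9876543210]),
  (14, 0xd7c9c5b8a9a6938483757264625141302010,
   [.branch 12, .embed 65 0xdb714280563ca9, .embed 0 0xdcba9876543210, .embed 282 0x1cd75]),
  (14, 0xd9d7c5b8a9a6938483757264625141302010,
   [.branch 13, .embed 182 0xbc8105423769da, .branch 10, .embed 283 0x3dba9, .branch 11,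
    .embed 312 0xdcba9876543210, .embed 283 0x1cd75]),
  (14, 0xd9d7c9c5b8a6938483757264625141302010,
   [.branch 12, .embed 2 0xb9dac786325401, .branch 11, .branch 10, .embed 314 0xdcba9876543210,
    .embed 284 0x3dbc9, .embed 284 0x1cd75]),
  (13, 0xc5b8a6938483757264625141302010,
   [.branch 7, .embed 9 0xb9ac786325401, .embed 285 0x7a62, .branch 11, .embed 285 0x9b83,
    .branch 10, .embed 8 0xcba9876543210, .embed 8 0x9bac786325401, .branch 9, .branch 9,
    .embed 7 0xdcba9876543210, .branch 9, .embed 7 0xdcba9876543210, .embed 285 0x1cb75, .branch 9,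
    .branch 9, .embed 6 0xdcba9876543210, .embed 5 0xdcba9876543210, .branch 9,
    .embed 6 0xdcba9876543210, .embed 4 0xdcba9876543210, .branch 9, .embed 5 0xdcba9876543210,
    .embed 4 0xdcba9876543210, .embed 46 0x21c75, .branch 9, .branch 9, .embed 285 0x9b83,
    .embed 2 0xdcba9876543210, .embed 1 0xdcba9876543210, .embed 285 0x9b83, .branch 9,
    .embed 2 0xdcba9876543210, .embed 285 0x9b83, .embed 0 0xdcba9876543210, .branch 9,
    .embed 1 0xdcba9876543210, .embed 285 0x9b83, .embed 0 0xdcba9876543210]),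
  (12, 0xb8a6938483757264625141302010,
   [.branch 5, .branch 7, .embed 269 0xba8640321975, .embed 286 0x7a62, .branch 9, .branch 10,
    .grow, .branch 12, .branch 12, .branch 11, .branch 12, .embed 23 0xdcba9876543210, .branch 12,
    .branch 12, .embed 286 0x9b83, .embed 20 0xcba9876543210, .branch 9, .embed 20 0xbac8967453210,
    .embed 286 0x9b83, .embed 286 0x19c75, .branch 10, .embed 18 0xdcba9876543210,
    .embed 18 0xdbca9786325401, .branch 10, .embed 19 0xdcba9876543210, .embed 19 0xdbca9786325401,
    .embed 24 0xa786325401, .branch 7, .branch 9, .branch 10, .grow, .branch 12, .branch 12,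
    .embed 17 0xcba9876543210, .embed 286 0x9b83, .embed 14 0xcba9876543210, .embed 286 0x7a62,
    .embed 207 0xa93640821b75, .embed 10 0xcba9876543210, .embed 0 0xcba9876543210]),
  (14, 0xd5c9c5b8b7a6979384837264625141302010,
   [.branch 12, .branch 10, .embed 17 0xd145063c8a29b7, .embed 287 0x1dac5, .embed 287 0x2bc97,
    .embed 48 0x91dc5]),
  (14, 0xd5c7c5b8a6979384837264625141302010,
   [.branch 9, .embed 0 0xdcab7698542310, .embed 288 0x9b83, .embed 184 0xbad41860532c97,
    .branch 12, .branch 10, .branch 11, .embed 319 0xdcba9876543210, .embed 288 0x1dac5,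
    .branch 11, .branch 10, .embed 320 0xdcba9876543210, .embed 288 0x1dbc5, .embed 288 0x2cd97]),
  (12, 0xb8a6979384837264625141302010,
   [.branch 5, .embed 2 0xba9876543210, .embed 2 0xab7698542310, .embed 2 0x97b3a2508614,
    .embed 2 0x79a2b3506814, .branch 5, .embed 13 0xb9ac786325401, .embed 13 0xa7bc968235401,
    .embed 3 0xc97b3a2508614, .embed 3 0xc79a2b3506814, .branch 7, .embed 289 0x7a62, .branch 9,
    .branch 10, .embed 289 0x2ba97, .embed 2 0x41c680b2a379, .embed 2 0x41d680b2a379,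
    .embed 289 0x9b83, .embed 1 0xdcba9876543210, .embed 1 0xcdba9876543210,
    .embed 0 0xdcba9876543210, .embed 0 0xcdba9876543210]),
  (14, 0xdbc7c5b8b7a69384837264625141302010,
   [.branch 5, .embed 4 0xcab7698542310, .embed 4 0xc97b3a2508614, .branch 12, .branch 9,
    .branch 10, .embed 323 0xdcba9876543210, .embed 290 0x1d9c5, .branch 10, .branch 9,
    .embed 322 0x4038692b1da75c, .embed 290 0x1dac5, .embed 290 0x2cdb7]),
  (13, 0xc7b8b7a69384837264625141302010,
   [.branch 11, .embed 4 0x79a2b3506814, .embed 291 0x9b83, .embed 1 0x97b3a2508614,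
    .embed 52 0x82cb7, .branch 5, .embed 4 0xab7698542310, .embed 4 0x97b3a2508614,
    .embed 0 0xdcba9876543210, .embed 0 0xcd79a2b3506814]),
  (14, 0xd7c7c5b8a69384837264625141302010,
   [.branch 5, .embed 6 0xcab7698542310, .embed 6 0xc97b3a2508614, .embed 6 0xc79a2b3506814,
    .embed 292 0x1d7c5]),
  (11, 0xa69384837264625141302010,
   [.branch 8, .embed 293 0x5841, .embed 32 0xa7698542310, .embed 54 0x40983, .embed 293 0x18a64,
    .branch 7, .embed 6 0xba9876543210, .embed 3 0xba9876543210, .embed 293 0x7a62, .branch 7,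
    .embed 6 0xba9876543210, .embed 3 0xba9876543210, .embed 293 0x7a62, .embed 1 0xcba9876543210,
    .branch 7, .embed 6 0xba9876543210, .embed 3 0xba9876543210, .embed 293 0x7a62,
    .embed 1 0xcba9876543210, .branch 5, .embed 6 0xab7698542310, .embed 6 0x97b3a2508614,
    .embed 6 0x79a2b3506814, .embed 0 0xdcba9876543210, .embed 0 0xcdba9876543210]),
  (10, 0x9384837264625141302010,
   [.branch 6, .embed 294 0x5641, .embed 55 0x40762, .embed 260 0x9750321864,
    .embed 32 0x9876543210, .embed 0 0xa9876543210]),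
  (12, 0xb6a7a493837264625141302010,
   [.branch 7, .embed 33 0xa5b4317602, .embed 1 0x58a31b47062, .embed 1 0x59a31b47062,
    .embed 295 0x7b62, .embed 1 0x5ca31b47062]),
  (14, 0xd7cac5b9b6a8a4959387837264625141302010,
   [.branch 11, .embed 296 0x1cb95, .branch 12, .embed 330 0xdcba9876543210]),
  (14, 0xd7cac5b6a8a4959387837264625141302010,
   [.branch 9, .embed 0 0xdcba9876543210, .embed 172 0xdb762840a31c95, .embed 3 0x65d12a79083]),
  (14, 0xd7d5cab6a8a4959387837264625141302010,
   [.branch 9, .branch 11, .branch 12, .embed 333 0xdcba9876543210, .embed 298 0x1db95,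
    .embed 1 0xbcda5467981230, .embed 218 0xcba62480713d59]),
  (14, 0xd7d5cac5b6a8a49387837264625141302010,
   [.branch 13, .embed 5 0x15960a3d287, .embed 0 0x5c9ab413d86072, .embed 162 0x93b2608471ad5c]),
  (13, 0xcab6a8a49387837264625141302010,
   [.branch 7, .embed 6 0xa4598671320, .embed 300 0x9783, .embed 300 0x7b62, .embed 300 0x2ca87,
    .branch 5, .branch 5, .embed 6 0x79b32a65041, .embed 2 0xdcba9876543210,
    .embed 1 0xdcba9876543210, .embed 4 0xab9854763120, .branch 5, .embed 2 0xdcba9876543210,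
    .embed 6 0x7cb32a65041, .embed 0 0xdcba9876543210, .branch 5, .embed 1 0xdcba9876543210,
    .embed 6 0x7db32a65041, .embed 0 0xdcba9876543210]),
  (14, 0xd8d5cab6a8a49593837264625141302010,
   [.branch 9, .embed 7 0xd6745892130, .embed 7 0x4ad21b58093, .embed 7 0x4ad21c58093,
    .embed 301 0x9d83]),
  (14, 0xd8cab6a8a49593837264625141302010,
   [.branch 5, .embed 8 0xb97a6325401, .embed 8 0x79b32a65041, .branch 9, .embed 8 0xc6745892130,
    .embed 1 0xdb86ac9234501, .embed 175 0xbd762840a31c95, .embed 302 0x9d83,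
    .embed 0 0xdcba9876543210]),
  (13, 0xcab6a8a493837264625141302010,
   [.branch 8, .branch 5, .embed 16 0xc96a23784051, .embed 303 0x9583, .embed 16 0x9c236ab80451,
    .embed 303 0x1ca85, .embed 13 0xc96a23d84051, .embed 2 0xcba9876543210, .embed 64 0xa0983,
    .embed 2 0x973c8b250a614, .embed 64 0x43ca8, .branch 5, .embed 7 0x37c850b2a164,
    .embed 0 0xdcba9876543210, .embed 7 0xab9854763120, .embed 0 0xd973c8b250a614, .branch 5,
    .embed 9 0xbd7a6325401, .embed 1 0xdcba9876543210, .embed 9 0x7db32a65041,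
    .embed 1 0xd973c8b250a614]),
  (12, 0xb6a8a493837264625141302010,
   [.branch 10, .embed 304 0x5a41, .embed 10 0x38750b2a164, .embed 304 0x9a83, .embed 304 0x1ab64,
    .embed 0 0xcba9876543210]),
  (14, 0xdacab6a49387837264625141302010,
   [.branch 7, .embed 11 0xa85b4317602, .embed 305 0x9783, .embed 305 0x7b62,
    .embed 1 0xd5a8c31b47062, .embed 1 0xc5a8d31b47062]),
  (11, 0xa493837264625141302010,
   [.branch 6, .embed 306 0x5641, .embed 67 0x40762, .embed 12 0xa9854763120,
    .embed 12 0xa8954763120, .embed 67 0x21a64, .branch 10, .embed 306 0x5a41,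
    .embed 10 0xba9876543210, .embed 1 0xba9876543210, .embed 1 0xba8976543210, .embed 306 0x1ab64,
    .branch 10, .embed 306 0x5a41, .embed 12 0x3c750b2a164, .embed 2 0xcba9876543210,
    .embed 2 0xcba8976543210, .embed 306 0x1ab64, .branch 7, .embed 10 0x37dc50b2a164,
    .embed 0 0xdcba9876543210, .embed 0 0xdcba8976543210, .embed 306 0x7b62,
    .embed 1 0x37dc50b2a164, .embed 1 0x37cd50b2a164]),
  (10, 0x93837264625141302010,
   [.branch 4, .embed 68 0x60541, .embed 307 0x7462, .embed 12 0x9876543210,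
    .embed 12 0x8976543210, .embed 0 0xa9876543210]),
  (14, 0xd5c6c5b4a8a6a4938372625141302010,
   [.branch 8, .embed 1 0xa5467981230, .embed 69 0xa0983, .embed 308 0x1b8a4, .embed 308 0x2c8a6,
    .branch 12, .embed 308 0x7c62, .branch 9, .embed 1 0xc5467891230, .branch 11, .branch 7,
    .embed 344 0xdcba9876543210, .embed 45 0x72603ca18594db, .embed 308 0x9d83,
    .embed 1 0x632abdc0451, .embed 186 0xb432a1865dc]),
  (14, 0xd5c6c5b4a6a4938372625141302010,
   [.branch 10, .embed 309 0x7a62, .embed 0 0xdcba9876543210, .embed 0 0xdcba8976543210,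
    .embed 70 0x61ba4, .embed 188 0x98730db12546ca, .embed 2 0x632cdba0541]),
  (14, 0xd5c5b4a6a4938372625141302010,
   [.branch 6, .embed 71 0xa0762, .embed 3 0xa5498761320, .embed 3 0xa5489761320,
    .embed 310 0x1b6a4, .embed 0 0xdcba9876543210, .embed 0 0xcdba9876543210]),
  -- A single vertex lies in every good cubic graph, so this entry completes the classification. The
  -- first three branchings build the star at vertex 0.
  (1, 0x0,
   [.branch 0, .branch 0, .branch 0, .branch 1, .embed 71 0x3210, .embed 71 0x2310, .branch 1,
    .embed 72 0x43210, .embed 72 0x42310, .branch 2, .embed 71 0x1320, .embed 311 0x32410,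
    .embed 311 0x32510, .branch 2, .embed 72 0x61320, .embed 311 0x32410, .embed 311 0x32510,
    .branch 3, .embed 311 0x23410, .embed 311 0x23510, .embed 311 0x13620, .embed 311 0x13720,
    .branch 3, .embed 311 0x23410, .embed 311 0x23510, .embed 311 0x13620, .embed 311 0x13720,
    .branch 4, .embed 71 0x541, .embed 3 0x9876543210, .embed 3 0x9867543210,
    .embed 3 0x7698542310, .embed 3 0x7689542310, .branch 4, .embed 72 0xa0541,
    .embed 4 0xa9876543210, .embed 4 0xa9867543210, .embed 4 0xa7698542310, .embed 4 0xa7689542310,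
    .branch 5, .embed 3 0x9876453210, .embed 3 0x9867453210, .embed 3 0x7698452310,
    .embed 3 0x7689452310, .embed 311 0x5a41, .embed 311 0x5b41, .branch 5, .embed 4 0xc9876453210,
    .embed 4 0xc9867453210, .embed 4 0xc7698452310, .embed 4 0xc7689452310, .embed 311 0x5a41,
    .embed 311 0x5b41, .branch 6, .embed 71 0x762, .embed 3 0x5498761320, .embed 3 0x5489761320,
    .embed 0 0xdcba9876543210, .embed 0 0xdcab9876543210, .embed 0 0xbadc9876453210,
    .embed 0 0xbacd9876453210])]

/-- All patterns with their steps; the last one is a single vertex. -/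
def searchList : List (ℕ × ℕ × List Step) :=
  searchList1 ++ searchList2 ++ searchList3 ++ searchList4 ++
  searchList5 ++ searchList6 ++ searchList7 ++ searchList8

/-- The cycle of length four with a pendant edge. -/
def banner : Pattern := [[1, 3, 4], [0, 2], [1, 3], [0, 2], [0]]
/-- The disjoint union of `K₄` and the pattern `T`. -/
def completeFourSum (T : Pattern) : Pattern :=
  [[1, 2, 3], [0, 2, 3], [0, 1, 3], [0, 1, 2]] ++ T.map (List.map (· + 4))

/-- The good cubic graphs. -/
def goodList : List Pattern := connectedList ++ tenList.map completeFourSum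

/-- The computation behind completeness. All the searching went into finding the data; the kernel
only replays the case distinctions and tests the given embeddings. -/
theorem settlesAll_searchList : settlesAll (banner :: goodList) searchList = true := by
  decide +kernel

/-! ### From tables to graphs -/

/-- The graph on `n` vertices whose neighbour lists are the rows of `P`. -/
def toGraph (n : ℕ) (P : Pattern) : SimpleGraph (Fin n) :=
  SimpleGraph.fromRel fun a b => (b : ℕ) ∈ row P a

/-- Whether `P` consists of the neighbour lists of a cubic graph on `n` vertices. -/
noncomputable def isCubicTable (n : ℕ) (P : Pattern) : Bool :=
  Nat.beq P.length n && (List.range n).all fun a =>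
    Nat.beq (row P a).length 3 && distinct (a :: row P a) &&
      (row P a).all fun b => Nat.blt b n && mem a (row P b)

/-- Whether every vertex but the first has a smaller neighbour. -/
noncomputable def hasDescent (n : ℕ) (P : Pattern) : Bool :=
  (List.range n).all fun a => Nat.beq a 0 || (row P a).any fun b => Nat.blt b a

/-- Whether two vertices that are neither equal nor adjacent have at most one common neighbour. -/
noncomputable def hasFewCommon (n : ℕ) (P : Pattern) : Bool :=
  (List.range n).all fun a => (List.range n).all fun b =>
    Nat.beq a b || mem b (row P a) ||
      Nat.ble ((row P a).filter fun c => mem c (row P b)).length 1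

/-- `P` consists of the neighbour lists of a cubic graph on `n` vertices. -/
structure CubicTable (n : ℕ) (P : Pattern) : Prop where
  length : P.length = n
  row_length : ∀ a < n, (row P a).length = 3
  nodup : ∀ a < n, (row P a).Nodup
  not_mem : ∀ a < n, a ∉ row P a
  lt : ∀ a < n, ∀ b ∈ row P a, b < n
  symm : ∀ a < n, ∀ b ∈ row P a, a ∈ row P b

theorem isCubicTable_spec {n : ℕ} {P : Pattern} (h : isCubicTable n P = true) :
    CubicTable n P := by
  simp only [isCubicTable, Bool.and_eq_true, Nat.beq_eq, List.all_eq_true, List.mem_range,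
    distinct_iff, mem_iff, Nat.blt_eq, List.nodup_cons] at h
  exact ⟨h.1, fun a ha => (h.2 a ha).1.1, fun a ha => (h.2 a ha).1.2.2,
    fun a ha => (h.2 a ha).1.2.1, fun a ha b hb => ((h.2 a ha).2 b hb).1,
    fun a ha b hb => ((h.2 a ha).2 b hb).2⟩

variable {n : ℕ} {P : Pattern}

/-- `SimpleGraph.fromRel` symmetrizes and removes loops; a cubic table is symmetric and loopless, so
neither has any effect. -/
theorem CubicTable.adj_iff (h : CubicTable n P) {a b : Fin n} :
    (toGraph n P).Adj a b ↔ (b : ℕ) ∈ row P a := by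
  rw [toGraph, SimpleGraph.fromRel_adj]
  constructor
  · rintro ⟨-, hb | hb⟩
    exacts [hb, h.symm b b.2 a hb]
  · intro hb
    refine ⟨?_, .inl hb⟩
    rintro rfl
    exact h.not_mem a a.2 hb

/-- The bridge from sums over the graph to list computations: constant `F` yields degrees and
bounds, general `F` the recursion for walks. -/
theorem CubicTable.sum_neighbors (h : CubicTable n P) (a : Fin n) (F : ℕ → ℕ) :
    (∑ b : Fin n, open Classical in if (toGraph n P).Adj a b then F b else 0) =
      ((row P a).map F).sum := by
  classical
  have h1 : ∑ b ∈ (row P a).toFinset, F b = ((row P a).map F).sum :=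
    List.sum_toFinset F (h.nodup a a.2)
  rw [← h1, ← Finset.sum_filter]
  refine Finset.sum_bij (fun b _ => (b : ℕ)) ?_ ?_ ?_ ?_
  · intro b hb
    simpa [h.adj_iff] using hb
  · intro b _ c _ hbc
    exact Fin.ext hbc
  · intro b hb
    rw [List.mem_toFinset] at hb
    exact ⟨⟨b, h.lt a a.2 b hb⟩, by simpa [h.adj_iff] using hb, rfl⟩
  · intro b _
    rfl

theorem CubicTable.isCubic (h : CubicTable n P) : (toGraph n P).IsCubic := by
  classical
  intro a
  have h1 := h.sum_neighbors a fun _ => 1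
  rw [Finset.sum_boole, List.map_const', List.sum_replicate, h.row_length a a.2] at h1
  rw [Set.ncard_eq_toFinset_card', ← SimpleGraph.neighborFinset_def,
    SimpleGraph.neighborFinset_eq_filter]
  simpa using h1

theorem CubicTable.isGoodCubic (h : CubicTable 14 P) (hc : hasFewCommon 14 P = true) :
    (toGraph 14 P).IsGoodCubic where
  card := by simp
  cubic := h.isCubic
  common := by
    intro a b hab hadj
    simp only [hasFewCommon, List.all_eq_true, List.mem_range, Bool.or_eq_true, Nat.beq_eq,
      mem_iff, Nat.ble_eq] at hc
    rw [h.adj_iff] at hadj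
    rcases hc a a.2 b b.2 with (hc | hc) | hc
    · exact (hab (Fin.ext hc)).elim
    · exact (hadj hc).elim
    · rw [Set.ncard_le_one (Set.toFinite _)]
      intro c hca d hda
      rw [SimpleGraph.mem_commonNeighbors, h.adj_iff, h.adj_iff] at hca hda
      have hm : ∀ {x : ℕ}, x ∈ row P a ∧ x ∈ row P b →
          x ∈ (row P a).filter fun c => mem c (row P b) := by
        intro x hx
        simpa [mem_iff] using hx
      have h1 := hm hca
      have h2 := hm hda
      -- Only the length of the list of common neighbours matters: a list with at most one entry has
      -- at most one member.
      generalize (row P a).filter (fun c => mem c (row P b)) = l at hc h1 h2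
      match l, hc with
      | [], _ => simp at h1
      | [x], _ => simp at h1 h2; exact Fin.ext (h1.trans h2.symm)

/-- Passing repeatedly to a smaller neighbour leads from any vertex to 0. -/
theorem CubicTable.connected (h : CubicTable (n + 1) P) (hd : hasDescent (n + 1) P = true) :
    (toGraph (n + 1) P).Connected := by
  have h0 : ∀ k (hk : k < n + 1), (toGraph (n + 1) P).Reachable ⟨k, hk⟩ 0 := by
    intro k
    induction k using Nat.strong_induction_on with
    | _ k ih =>
      intro hk
      simp only [hasDescent, List.all_eq_true, List.mem_range, Bool.or_eq_true, Nat.beq_eq,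
        List.any_eq_true, Nat.blt_eq] at hd
      rcases hd k hk with rfl | ⟨b, hb, hbk⟩
      · exact .rfl
      · have hadj : (toGraph (n + 1) P).Adj ⟨k, hk⟩ ⟨b, hbk.trans hk⟩ := h.adj_iff.2 hb
        exact hadj.reachable.trans (ih b hbk _)
  exact ⟨fun a b => (h0 a a.2).trans (h0 b b.2).symm⟩

/-- Both sides have 14 vertices, so the embedding is bijective. The table already supplies three
neighbours at each vertex, so `H` has no room for another edge. -/
theorem CubicTable.nonempty_iso {W : Type*} {H : SimpleGraph W} (h : CubicTable 14 P)
    (hH : H.IsGoodCubic) {f : ℕ → W} (hf : Realizes H P f) : Nonempty (H ≃g toGraph 14 P) := by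
  have := hH.finite
  have hb : Function.Bijective (fun a : Fin 14 => f a) :=
    (Nat.bijective_iff_injective_and_card _).2
      ⟨fun a b hab => Fin.ext (hf.inj a (by rw [h.length]; exact a.2) b
        (by rw [h.length]; exact b.2) hab), by simp [hH.card]⟩
  refine ⟨SimpleGraph.Iso.symm ⟨Equiv.ofBijective _ hb, ?_⟩⟩
  intro a b
  rw [h.adj_iff, Equiv.ofBijective_apply, Equiv.ofBijective_apply]
  refine ⟨fun hab => ?_, fun hab => (hf.adj a b hab).2⟩
  have h1 : f b ∈ f '' {c | c ∈ row P a} := by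
    rwa [hf.image_row_eq hH (h.nodup a a.2) (h.row_length a a.2).ge]
  obtain ⟨c, hc, hcb⟩ := h1
  have := hf.inj c (hf.adj a c hc).1 b (by rw [h.length]; exact b.2) hcb
  rwa [← this]

/-- The pendant edge fills up the neighbourhood of the corner 0. Hence 0 is not adjacent to the
opposite corner 2, yet they share the neighbours 1 and 3. -/
theorem not_realizes_banner {W : Type*} {H : SimpleGraph W} (hH : H.IsGoodCubic) {f : ℕ → W} :
    ¬ Realizes H banner f := by
  intro h
  have := hH.finite
  have adj : ∀ a b : ℕ, b ∈ row banner a → H.Adj (f a) (f b) := fun a b hb => (h.adj a b hb).2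
  have ne : ∀ a < 5, ∀ b < 5, a ≠ b → f a ≠ f b := fun a ha b hb hab he => hab (h.inj a ha b hb he)
  have hrow : row banner 0 = [1, 3, 4] := rfl
  have h02 : ¬ H.Adj (f 0) (f 2) := by
    intro h2
    have h1 : f 2 ∈ f '' {c | c ∈ row banner 0} := by
      rwa [h.image_row_eq hH (by rw [hrow]; decide) (by rw [hrow]; decide)]
    obtain ⟨c, hc, hcb⟩ := h1
    rw [Set.mem_ofPred_eq, hrow] at hc
    have h5 : c < 5 ∧ c ≠ 2 := by
      simp only [List.mem_cons, List.not_mem_nil, or_false] at hc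
      omega
    exact ne c h5.1 2 (by decide) h5.2 hcb
  have h1 := hH.common (f 0) (f 2) (ne 0 (by decide) 2 (by decide) (by decide)) h02
  rw [Set.ncard_le_one (Set.toFinite _)] at h1
  refine ne 1 (by decide) 3 (by decide) (by decide) (h1 _ ⟨?_, ?_⟩ _ ⟨?_, ?_⟩)
  · exact adj 0 1 (by rw [hrow]; decide)
  · exact adj 2 1 (by rw [show row banner 2 = [1, 3] from rfl]; decide)
  · exact adj 0 3 (by rw [hrow]; decide)
  · exact adj 2 3 (by rw [show row banner 2 = [1, 3] from rfl]; decide)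

end Pattern

/-! ### An isomorphism invariant from closed walks -/

open Classical in
/-- The number of walks of length `k` from `u` to `v`. -/
noncomputable def SimpleGraph.walks {V : Type*} [Fintype V] (G : SimpleGraph V) : ℕ → V → V → ℕ
  | 0, u, v => if u = v then 1 else 0
  | k + 1, u, v => ∑ w, if G.Adj u w then G.walks k w v else 0

theorem SimpleGraph.Iso.walks_apply {V W : Type*} [Fintype V] [Fintype W] {G : SimpleGraph V}
    {H : SimpleGraph W} (e : G ≃g H) (k : ℕ) (u v : V) :
    H.walks k (e u) (e v) = G.walks k u v := by
  classical
  induction k generalizing u with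
  | zero => exact if_congr e.injective.eq_iff rfl rfl
  | succ k ih =>
    refine (Fintype.sum_equiv e.toEquiv _ _ fun w => ?_).symm
    exact if_congr e.map_adj_iff.symm (ih w).symm rfl

theorem SimpleGraph.Iso.sum_walks_sq {V W : Type*} [Fintype V] [Fintype W] {G : SimpleGraph V}
    {H : SimpleGraph W} (e : G ≃g H) (k : ℕ) :
    ∑ v, H.walks k v v ^ 2 = ∑ v, G.walks k v v ^ 2 :=
  (Fintype.sum_equiv e.toEquiv _ _ fun v => by
    rw [← e.walks_apply]; rfl).symm

namespace Pattern

variable {n : ℕ} {P : Pattern}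

/-- The entry of a list of natural numbers at the place `a`, or `0`. -/
noncomputable def entry (l : List ℕ) (a : ℕ) : ℕ :=
  List.rec (fun _ => 0) (fun x _ ih a => Nat.rec x (fun a _ => ih a) a) l a

theorem entry_eq_getD (l : List ℕ) (a : ℕ) : entry l a = l.getD a 0 := by
  induction l generalizing a with
  | nil => rfl
  | cons x l ih =>
    cases a with
    | zero => rfl
    | succ a => exact ih a

theorem entry_map {F : List ℕ → ℕ} {a : ℕ} (h : a < P.length) :
    entry (P.map F) a = F (row P a) := by
  simp [entry_eq_getD, row_eq_getD, h]

/-- For every vertex the sum of the numbers in `R` that belong to its neighbours. -/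
noncomputable def sumNeighbors (P : Pattern) (R : List ℕ) : List ℕ :=
  P.map fun r => (r.map (entry R)).sum

/-- The `k`-fold iteration of `sumNeighbors`. -/
noncomputable def iterateSum (P : Pattern) : ℕ → List ℕ → List ℕ
  | 0, R => R
  | k + 1, R => forceRow (sumNeighbors P R) fun R => iterateSum P k R

/-- The sum of the squares of the numbers of closed walks of length seven at the vertices, where the
numbers of walks from a vertex are the digits of one number in base `4096`. -/
noncomputable def walkInvariant (P : Pattern) : ℕ :=
  forceRow (iterateSum P 7 ((List.range 14).map fun a => 4096 ^ a)) fun R =>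
    ((List.range 14).map fun a => (entry R a / 4096 ^ a % 4096) ^ 2).sum

/-- The coefficients are smaller than the base, so they are the digits; each division by `B` removes
the lowest one, which gives the induction. -/
theorem sum_div_pow_mod (B : ℕ) (c : Fin n → ℕ) (hc : ∀ a, c a < B) (a : Fin n) :
    (∑ b, c b * B ^ (b : ℕ)) / B ^ (a : ℕ) % B = c a := by
  induction n with
  | zero => exact a.elim0
  | succ n ih =>
    have hB : 0 < B := (Nat.zero_le _).trans_lt (hc a)
    have h1 : ∑ b, c b * B ^ (b : ℕ) = c 0 + B * ∑ b : Fin n, c b.succ * B ^ (b : ℕ) := by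
      rw [Fin.sum_univ_succ, Finset.mul_sum]
      simp only [Fin.val_zero, pow_zero, mul_one, Fin.val_succ, pow_succ]
      congr 1
      exact Finset.sum_congr rfl fun b _ => by ring
    rw [h1]
    refine Fin.cases ?_ (fun a => ?_) a
    · simp [Nat.mod_eq_of_lt (hc 0)]
    · rw [Fin.val_succ, pow_succ', ← Nat.div_div_eq_div_mul, Nat.add_mul_div_left _ _ hB,
        Nat.div_eq_of_lt (hc 0), zero_add]
      exact ih (fun b => c b.succ) (fun b => hc _) a

/-- Each step of a walk has three choices. For length seven this gives 3⁷ = 2187 < 4096, so base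
4096 holds the counts without carries. -/
theorem CubicTable.walks_le (h : CubicTable n P) (k : ℕ) (u v : Fin n) :
    (toGraph n P).walks k u v ≤ 3 ^ k := by
  classical
  induction k generalizing u with
  | zero => rw [SimpleGraph.walks]; split_ifs <;> simp
  | succ k ih =>
    have h1 := h.sum_neighbors u fun _ => 3 ^ k
    rw [List.map_const', List.sum_replicate, h.row_length u u.2] at h1
    rw [SimpleGraph.walks, pow_succ', ← smul_eq_mul, ← h1]
    refine Finset.sum_le_sum fun w _ => ?_
    split_ifs
    exacts [ih w, le_rfl]

/-- Summing over neighbours applies the adjacency matrix, so `k` rounds turn the `j`-th power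
applied to `F` into the `(j + k)`-th. The offset `j` makes the induction go through. -/
theorem CubicTable.entry_iterateSum (h : CubicTable n P) (k j : ℕ) (R : List ℕ) (F : Fin n → ℕ)
    (hR : ∀ u : Fin n, entry R u = ∑ v, (toGraph n P).walks j u v * F v) (u : Fin n) :
    entry (iterateSum P k R) u = ∑ v, (toGraph n P).walks (j + k) u v * F v := by
  classical
  induction k generalizing j R with
  | zero => exact hR u
  | succ k ih =>
    rw [iterateSum, forceRow_eq, ih (j + 1), Nat.add_right_comm, Nat.add_assoc]
    intro u
    rw [sumNeighbors, entry_map (by rw [h.length]; exact u.2), ← h.sum_neighbors]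
    simp only [SimpleGraph.walks, hR, Finset.sum_mul]
    rw [Finset.sum_comm]
    refine Finset.sum_congr rfl fun w _ => ?_
    split_ifs <;> simp

/-- Starting with `4096 ^ v` at the vertex `v` packs a whole row of the seventh power of the
adjacency matrix into one number; digit `u` of the entry at `u` is the diagonal entry. -/
theorem CubicTable.walkInvariant_eq (h : CubicTable 14 P) :
    walkInvariant P = ∑ v, (toGraph 14 P).walks 7 v v ^ 2 := by
  classical
  have h1 (f : ℕ → ℕ) : ((List.range 14).map f).sum = ∑ a : Fin 14, f a := by
    rw [← Finset.sum_range, Finset.sum, Finset.range_val, Multiset.range, Multiset.map_coe,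
      Multiset.sum_coe]
  rw [walkInvariant, forceRow_eq, h1]
  refine Finset.sum_congr rfl fun u _ => ?_
  have h2 := h.entry_iterateSum 7 0 ((List.range 14).map fun a => 4096 ^ a)
    (fun v => 4096 ^ (v : ℕ)) (fun u => ?_) u
  · rw [h2, Nat.zero_add, sum_div_pow_mod 4096 _ fun v => (h.walks_le 7 u v).trans_lt (by norm_num)]
  -- Walks of length zero form the identity matrix, so the initial list is the case `j = 0`.
  · simp [entry_eq_getD, SimpleGraph.walks]

/-! ### Kernel checks and the classification -/

theorem length_goodList : goodList.length = 39 := by decide +kernel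

theorem isCubicTable_goodList : goodList.all (isCubicTable 14) = true := by decide +kernel

theorem hasFewCommon_goodList : goodList.all (hasFewCommon 14) = true := by decide +kernel

theorem hasDescent_connectedList : connectedList.all (hasDescent 14) = true := by decide +kernel

theorem isCubicTable_tenList : tenList.all (isCubicTable 10) = true := by decide +kernel

theorem hasDescent_tenList : tenList.all (hasDescent 10) = true := by decide +kernel

theorem distinct_walkInvariant_goodList : distinct (goodList.map walkInvariant) = true := by
  decide +kernel

/-- The `i`-th good cubic graph. -/
def goodGraph (i : Fin 39) : SimpleGraph (Fin 14) := toGraph 14 (goodList.getD i [])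

/-- The `j`-th connected cubic graph on ten vertices without a cycle of length four. -/
def tenGraph (j : Fin 3) : SimpleGraph (Fin 10) := toGraph 10 (tenList.getD j [])

theorem goodList_getD_mem (i : Fin 39) : goodList.getD i [] ∈ goodList := by
  have hi : (i : ℕ) < goodList.length := i.2.trans_eq length_goodList.symm
  rw [List.getD_eq_getElem _ _ hi]
  exact List.getElem_mem hi

theorem cubicTable_goodList {P : Pattern} (h : P ∈ goodList) : CubicTable 14 P :=
  isCubicTable_spec (List.all_eq_true.1 isCubicTable_goodList P h)

theorem isGoodCubic_goodGraph (i : Fin 39) : (goodGraph i).IsGoodCubic :=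
  (cubicTable_goodList (goodList_getD_mem i)).isGoodCubic
    (List.all_eq_true.1 hasFewCommon_goodList _ (goodList_getD_mem i))

theorem isEmpty_iso_goodGraph {i j : Fin 39} (hij : i ≠ j) :
    IsEmpty (goodGraph i ≃g goodGraph j) := by
  refine ⟨fun e => hij ?_⟩
  have h1 := e.sum_walks_sq 7
  rw [goodGraph, goodGraph, ← (cubicTable_goodList (goodList_getD_mem i)).walkInvariant_eq,
    ← (cubicTable_goodList (goodList_getD_mem j)).walkInvariant_eq] at h1
  have hd := distinct_iff.1 distinct_walkInvariant_goodList
  have hi : (i : ℕ) < goodList.length := i.2.trans_eq length_goodList.symm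
  have hj : (j : ℕ) < goodList.length := j.2.trans_eq length_goodList.symm
  rw [List.getD_eq_getElem _ _ hi, List.getD_eq_getElem _ _ hj] at h1
  refine Fin.ext ((hd.getElem_inj_iff (hi := by simpa using hi) (hj := by simpa using hj)).1 ?_)
  rw [List.getElem_map, List.getElem_map]
  exact h1.symm

/-- These are the leaves of the search at which a complete graph has been reached. -/
theorem forced_goodList {P : Pattern} (h : P ∈ goodList) : Forced goodGraph P := by
  intro W H f hH hf
  obtain ⟨i, hi, rfl⟩ := List.getElem_of_mem h
  refine ⟨⟨i, length_goodList ▸ hi⟩, ?_⟩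
  rw [goodGraph, List.getD_eq_getElem _ _ hi]
  exact (cubicTable_goodList h).nonempty_iso hH hf

/-- The known patterns at the start are `banner`, forced vacuously, and the good graphs themselves.
The last certificate then applies to the one-vertex pattern, which any vertex of `H` realizes. -/
theorem exists_iso_goodGraph {W : Type*} {H : SimpleGraph W} (hH : H.IsGoodCubic) :
    ∃ i, Nonempty (H ≃g goodGraph i) := by
  have hdb : ∀ Q ∈ banner :: goodList, Forced goodGraph Q :=
    List.forall_mem_cons.2 ⟨fun W H f hH hf => (not_realizes_banner hH hf).elim,
      fun Q hQ => forced_goodList hQ⟩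
  have hP : Forced goodGraph (ofCode 1 0) :=
    forced_of_settlesAll searchList _ hdb settlesAll_searchList (1, 0, _)
      (List.mem_append_right _ (List.mem_of_getLast? (by rfl)))
  have := hH.finite
  have : Nonempty W := (Nat.card_pos_iff.1 (by rw [hH.card]; decide)).1
  rw [show ofCode 1 0 = [[]] by rfl] at hP
  -- A constant map suffices, since injectivity is only required on the single vertex 0.
  refine hP W H (fun _ => Classical.arbitrary W) hH ⟨?_, ?_⟩
  · intro a ha b hb _
    simp at ha hb
    omega
  · intro a b hb
    cases a <;> exact absurd hb List.not_mem_nil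

theorem cubicTable_tenList (j : Fin 3) : CubicTable 10 (tenList.getD j []) := by
  have hj : (j : ℕ) < tenList.length := j.2
  rw [List.getD_eq_getElem _ _ hj]
  exact isCubicTable_spec (List.all_eq_true.1 isCubicTable_tenList _ (List.getElem_mem hj))

theorem connected_tenGraph (j : Fin 3) : (tenGraph j).Connected := by
  refine (cubicTable_tenList j).connected ?_
  have hj : (j : ℕ) < tenList.length := j.2
  rw [List.getD_eq_getElem _ _ hj]
  exact List.all_eq_true.1 hasDescent_tenList _ (List.getElem_mem hj)

theorem connected_goodGraph {i : Fin 39} (hi : (i : ℕ) < 36) : (goodGraph i).Connected := by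
  refine (cubicTable_goodList (goodList_getD_mem i)).connected ?_
  have hi' : (i : ℕ) < connectedList.length := hi
  rw [goodList, List.getD_append _ _ _ _ hi', List.getD_eq_getElem _ _ hi']
  exact List.all_eq_true.1 hasDescent_connectedList _ (List.getElem_mem hi')

/-! ### Disjoint unions with K₄ and the Petersen graph -/

theorem mem_row_completeFourSum (T : Pattern) (a : Fin 4) (b : Fin 14) :
    (b : ℕ) ∈ row (completeFourSum T) a ↔ (b : ℕ) < 4 ∧ (a : ℕ) ≠ b := by
  have h : row (completeFourSum T) a =
      row [[1, 2, 3], [0, 2, 3], [0, 1, 3], [0, 1, 2]] a := by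
    fin_cases a <;> rfl
  rw [h]
  clear h
  revert a b
  decide +kernel

theorem row_completeFourSum_add (T : Pattern) (a : ℕ) :
    row (completeFourSum T) (4 + a) = (row T a).map (· + 4) := by
  rw [Nat.add_comm, row_eq_getD, row_eq_getD]
  change (T.map (List.map (· + 4))).getD a (List.map (· + 4) []) = _
  rw [List.getD_map]

/-- The last graphs are disjoint unions of `K₄` and a graph on ten vertices. -/
theorem nonempty_iso_sum (j : Fin 3) :
    Nonempty (goodGraph (Fin.natAdd 36 j) ≃g
      SimpleGraph.sum (⊤ : SimpleGraph (Fin 4)) (tenGraph j)) := by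
  have h1 : goodList.getD (Fin.natAdd 36 j) [] = completeFourSum (tenList.getD j []) := by
    fin_cases j <;> rfl
  have h2 := cubicTable_goodList (goodList_getD_mem (Fin.natAdd 36 j))
  rw [h1] at h2
  rw [goodGraph, h1]
  -- `finSumFinEquiv` places K₄ on 0, …, 3 and shifts the other summand by 4, exactly as
  -- `completeFourSum` does.
  refine ⟨SimpleGraph.Iso.symm ⟨finSumFinEquiv, ?_⟩⟩
  intro a b
  rw [h2.adj_iff]
  rcases a with a | a
  · rw [finSumFinEquiv_apply_left, Fin.val_castAdd, mem_row_completeFourSum]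
    rcases b with b | b
    · rw [finSumFinEquiv_apply_left, Fin.val_castAdd]
      simp [Fin.ext_iff]
    · rw [finSumFinEquiv_apply_right, Fin.val_natAdd]
      simp
  · rw [finSumFinEquiv_apply_right, Fin.val_natAdd, row_completeFourSum_add]
    rcases b with b | b
    · rw [finSumFinEquiv_apply_left, Fin.val_castAdd]
      simp
      omega
    · rw [finSumFinEquiv_apply_right, Fin.val_natAdd, SimpleGraph.sum_adj_inr, tenGraph,
        (cubicTable_tenList j).adj_iff]
      simp [Nat.add_comm 4]

theorem nonempty_iso_petersenGraph : Nonempty (tenGraph 2 ≃g petersenGraph) := by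
  -- Vertex 0 is {0, 1}, and its neighbours 1, 2, 3 are the pairs inside {2, 3, 4}; the remaining
  -- labels fit the last table of `tenList`.
  let g : Fin 10 → Finset (Fin 5) :=
    ![{0, 1}, {2, 3}, {2, 4}, {3, 4}, {0, 4}, {1, 4}, {1, 3}, {0, 3}, {1, 2}, {0, 2}]
  have hg : ∀ a, (g a).card = 2 := by decide
  have hi : ∀ a b, g a = g b → a = b := by decide
  have hb : Function.Bijective fun a => (⟨g a, hg a⟩ : {s : Finset (Fin 5) // s.card = 2}) := by
    refine (Fintype.bijective_iff_injective_and_card _).2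
      ⟨fun a b hab => hi a b (congrArg Subtype.val hab), ?_⟩
    rw [Fintype.card_finset_len]
    rfl
  refine ⟨⟨Equiv.ofBijective _ hb, ?_⟩⟩
  intro a b
  rw [tenGraph, (cubicTable_tenList 2).adj_iff]
  change Disjoint (g a) (g b) ↔ _
  revert a b
  decide +kernel

theorem connected_goodGraph_iff {i : Fin 39} : (goodGraph i).Connected ↔ (i : ℕ) < 36 := by
  refine ⟨fun h => ?_, connected_goodGraph⟩
  by_contra hi
  obtain ⟨j, rfl⟩ : ∃ j : Fin 3, Fin.natAdd 36 j = i :=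
    ⟨⟨i - 36, by omega⟩, Fin.ext (by simp; omega)⟩
  obtain ⟨e⟩ := nonempty_iso_sum j
  exact SimpleGraph.not_connected_sum (e.connected_iff.1 h)

/-- A sum of two nonempty graphs is disconnected, which excludes the first 36 graphs; the others
carry the decomposition by construction. -/
theorem exists_iso_sum_iff {i : Fin 39} :
    (∃ T : SimpleGraph (Fin 10), T.Connected ∧ T.IsCubic ∧
      Nonempty (goodGraph i ≃g SimpleGraph.sum (⊤ : SimpleGraph (Fin 4)) T)) ↔ 36 ≤ (i : ℕ) := by
  constructor
  · rintro ⟨T, -, -, ⟨e⟩⟩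
    by_contra hi
    exact SimpleGraph.not_connected_sum (e.connected_iff.1 (connected_goodGraph (not_le.1 hi)))
  · intro hi
    obtain ⟨j, rfl⟩ : ∃ j : Fin 3, Fin.natAdd 36 j = i :=
      ⟨⟨i - 36, by omega⟩, Fin.ext (by simp; omega)⟩
    exact ⟨tenGraph j, connected_tenGraph j, (cubicTable_tenList j).isCubic, nonempty_iso_sum j⟩

end Pattern

/-! ### Local graphs of strongly regular graphs -/

theorem SimpleGraph.ncard_neighborSet_induce {V : Type*} (G : SimpleGraph V) (s : Set V) (v : s) :
    ((G.induce s).neighborSet v).ncard = (s ∩ G.neighborSet v).ncard := by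
  rw [← Set.ncard_image_of_injective _ Subtype.val_injective]
  congr 1
  ext w
  simp [and_comm]

theorem SimpleGraph.IsSRGWith.isGoodCubic_localGraph {V : Type*} [Fintype V] [DecidableEq V]
    {G : SimpleGraph V} [DecidableRel G.Adj] (h : G.IsSRGWith 85 14 3 2) (x : V) :
    (G.localGraph x).IsGoodCubic where
  card := by
    rw [Nat.card_eq_fintype_card, SimpleGraph.card_neighborSet_eq_degree]
    exact h.regular x
  cubic := by
    intro v
    rw [SimpleGraph.ncard_neighborSet_induce, ← h.of_adj x v v.2, Set.ncard_eq_toFinset_card',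
      Set.toFinset_card]
    exact Fintype.card_congr (.refl _)
  common := by
    intro v w hvw hadj
    have h1 := h.of_not_adj (fun h => hvw (Subtype.ext h) : (v : V) ≠ w) hadj
    -- The inclusion is strict: `x` is a common neighbour of `v` and `w` in `G` but not a vertex of
    -- its own neighbourhood. So fewer than two common neighbours remain.
    have h2 : Subtype.val '' (G.localGraph x).commonNeighbors v w ⊂ G.commonNeighbors v w := by
      refine (Set.ssubset_iff_of_subset ?_).2 ⟨x, ⟨v.2.symm, w.2.symm⟩, ?_⟩
      · rintro _ ⟨u, hu, rfl⟩
        exact hu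
      · rintro ⟨u, -, hu⟩
        have h3 := u.2
        rw [hu] at h3
        exact G.loopless.irrefl x h3
    have h3 := Set.ncard_lt_ncard h2 (Set.toFinite _)
    rw [Set.ncard_image_of_injective _ Subtype.val_injective, Set.ncard_eq_toFinset_card'
      (G.commonNeighbors v w), Set.toFinset_card, h1] at h3
    omega

theorem mainTheorem2 :
    -- every local subgraph of an srg(85,14,3,2) is a good cubic graph
    (∀ (V : Type*) [Fintype V] [DecidableEq V] (G : SimpleGraph V) [DecidableRel G.Adj],
      G.IsSRGWith 85 14 3 2 → ∀ x : V, (G.localGraph x).IsGoodCubic) ∧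
    -- there is a list of 39 graphs such that
    ∃ L : Fin 39 → SimpleGraph (Fin 14),
      -- all of them are good, and they are pairwise non-isomorphic
      (∀ i, (L i).IsGoodCubic) ∧
      (∀ i j, i ≠ j → IsEmpty (L i ≃g L j)) ∧
      -- every good cubic graph is isomorphic to one of them
      (∀ (W : Type*) (H : SimpleGraph W), H.IsGoodCubic → ∃ i, Nonempty (H ≃g L i)) ∧
      -- in particular so is every local subgraph of an srg(85,14,3,2)
      (∀ (V : Type*) [Fintype V] [DecidableEq V] (G : SimpleGraph V) [DecidableRel G.Adj],
        G.IsSRGWith 85 14 3 2 → ∀ x : V, ∃ i, Nonempty (G.localGraph x ≃g L i)) ∧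
      -- 36 of them are connected
      {i | (L i).Connected}.ncard = 36 ∧
      -- the other 3 are disjoint unions of `K₄` and a connected cubic graph on 10 vertices
      {i | ∃ T : SimpleGraph (Fin 10), T.Connected ∧ T.IsCubic ∧
        Nonempty (L i ≃g (SimpleGraph.sum (⊤ : SimpleGraph (Fin 4)) T))}.ncard = 3 ∧
      (∀ i, ¬ (L i).Connected → ∃ T : SimpleGraph (Fin 10), T.Connected ∧ T.IsCubic ∧
        Nonempty (L i ≃g (SimpleGraph.sum (⊤ : SimpleGraph (Fin 4)) T))) ∧
      -- one of these is the disjoint union of `K₄` and the Petersen graph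
      ∃ i, Nonempty (L i ≃g (SimpleGraph.sum (⊤ : SimpleGraph (Fin 4)) petersenGraph)) := by
  refine ⟨fun V _ _ G _ h x => h.isGoodCubic_localGraph x,
    Pattern.goodGraph, Pattern.isGoodCubic_goodGraph,
    fun i j hij => Pattern.isEmpty_iso_goodGraph hij, fun W H hH => Pattern.exists_iso_goodGraph hH,
    fun V _ _ G _ h x => Pattern.exists_iso_goodGraph (h.isGoodCubic_localGraph x), ?_, ?_, ?_, ?_⟩
  · simp only [Pattern.connected_goodGraph_iff]
    rw [Set.ncard_eq_toFinset_card']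
    rfl
  · simp only [Pattern.exists_iso_sum_iff]
    rw [Set.ncard_eq_toFinset_card']
    rfl
  · intro i hi
    rw [Pattern.connected_goodGraph_iff] at hi
    exact Pattern.exists_iso_sum_iff.2 (not_lt.1 hi)
  -- Index 2 is the last graph of `tenList`, the Petersen graph.
  · obtain ⟨e⟩ := Pattern.nonempty_iso_sum 2
    obtain ⟨e'⟩ := Pattern.nonempty_iso_petersenGraph
    exact ⟨_, ⟨e.trans (SimpleGraph.Iso.sumCongr .refl e')⟩⟩
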